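/- There is an absolute constant $C>0$ such that for every real $\alpha>1$ and every integer $n\ge 0$ there is a non-empty set $X\subseteq S_n$ of permutations of $[n]=\{1,\dots,n\}$ with $$|X|\le \exp\Big(C\,\frac n\alpha\,(1+\log^2\alpha)\Big)$$ such that the uniform distribution $\mathcal U(X)$ on $X$ is backwards $\alpha$-uniform. Here a distribution $\mathcal D$ on $S_n$ is called backwards $\alpha$-uniform if for every $Y\subseteq[n]$ with $\Pr_{\pi\sim\mathcal D}[\pi(\{1,\dots,|Y|\})=Y]>0$ and every $x\in Y$, $$\Pr_{\pi\sim\mathcal D}\big[\pi(|Y|)=x \,\big|\, \pi(\{1,\dots,|Y|\})=Y\big]\le \frac{\alpha}{|Y|}.$$ -/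

import Mathlib

open Finset

/-- The set `π([m]) = {π(1), …, π(m)}` of the first `m` elements of the permutation `π`.
Positions and elements are indexed by `Fin n`, so the position called `i` in `1, …, n` is
the element of `Fin n` with value `i - 1`. -/
def prefixSet {n : ℕ} (π : Equiv.Perm (Fin n)) (m : ℕ) : Finset (Fin n) :=
  (univ.filter fun j : Fin n => (j : ℕ) < m).image π

/-- The probability `Pr_{π ∼ D}[E]` of an event `E`. -/
noncomputable def prob {n : ℕ} (D : PMF (Equiv.Perm (Fin n)))
    (E : Set (Equiv.Perm (Fin n))) : ENNReal :=
  D.toOuterMeasure E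

/-- The conditional probability `Pr_{π ∼ D}[E | F]`, used only when `F` has positive
probability. -/
noncomputable def condProb {n : ℕ} (D : PMF (Equiv.Perm (Fin n)))
    (E F : Set (Equiv.Perm (Fin n))) : ENNReal :=
  prob D (E ∩ F) / prob D F

/-- `D` is backwards `α`-uniform: for every set `Y` with `Pr[π([|Y|]) = Y] > 0` and every
`x ∈ Y`, `Pr[π(|Y|) = x | π([|Y|]) = Y] ≤ α / |Y|`. The index `i` with `i + 1 = |Y|` is the
position `|Y|`; it exists and is unique whenever `Y` is nonempty. -/
def BackwardsUniform {n : ℕ} (D : PMF (Equiv.Perm (Fin n))) (α : ℝ) : Prop :=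
  ∀ Y : Finset (Fin n), 0 < prob D {π | prefixSet π #Y = Y} →
    ∀ x ∈ Y, ∀ i : Fin n, (i : ℕ) + 1 = #Y →
      condProb D {π | π i = x} {π | prefixSet π #Y = Y} ≤ ENNReal.ofReal (α / (#Y : ℝ))

/-! Read backwards, a permutation is a list, and the condition says: given that the first `k`
entries form a set `R`, every element comes next with probability (its hazard) at most `α / (n -
k)`. Only the set `R` is conditioned on, never its order. Hence randomness that affects only the
order inside a block, once the block's set is fixed, is still fresh afterwards and can be reused.
This saves the seeds.

For large `α`, take `h` about `4n/α` and `m = 2^L * h` between `n/4` and `n/2`. `partialFamily`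
lists all but `h` elements of an `m`-set with hazard at most `4/h ≤ α/n`, using `2^(9h(L+1)²)`
seeds, where `L = O(log α)`. At most `7n/8` elements remain; `FullFamily.extend` orders them
recursively, and the costs form a geometric series. For bounded `α`, the `16^n` orderings of
`exactFamily` suffice.

The partial list comes from a `Scheme`: in a set of size `2^d * h`, a random `h`-set `u` survives,
and a seed orders the complement of `u`. `Scheme.succ` merges two copies with independent survivors
but the same seed (`hazAt_mergeList`), then lists a random half of the `2h` survivors; the other
half survives. To use the result again, the history leading to a survivor set is drawn from a fresh
seed with `M` values, approximating the conditional law (`exists_coupling`). Every survivor set has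
mass at least `16^(-dh)` (`sum_surv_ge`), so `log M = O(h(L+1))`. Paying for `M` in `L` merges and
one final rounding gives the squared logarithm. -/

/-- The list `l` first enumerates the set `R` and then continues with `x`. -/
def Hits {V : Type} [DecidableEq V] (l : List V) (R : Finset V) (x : V) : Prop :=
  (l.take #R).toFinset = R ∧ l[#R]? = some x

/-- The list `l` first enumerates the set `R` and does not end there. -/
def Vis {V : Type} [DecidableEq V] (l : List V) (R : Finset V) : Prop :=
  (l.take #R).toFinset = R ∧ #R < l.length

open Classical in
/-- The total weight of the indices whose list satisfies `Q`. -/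
noncomputable def mass {Ω V : Type} [Fintype Ω] (w : Ω → ℝ) (l : Ω → List V)
    (Q : List V → Prop) : ℝ :=
  ∑ ω, if Q (l ω) then w ω else 0

/-- In the weighted family of lists `l`, given that the first `k` entries form a set `R`, every
element comes next with conditional probability at most `β`. -/
def HazAt {Ω V : Type} [Fintype Ω] [DecidableEq V] (k : ℕ) (β : ℝ) (w : Ω → ℝ)
    (l : Ω → List V) : Prop :=
  ∀ R : Finset V, #R = k → ∀ x, mass w l (Hits · R x) ≤ β * mass w l (Vis · R)

/-! ### Lists under concatenation and relabelling -/

theorem exists_of_hits_map {V V' : Type} [DecidableEq V'] (e : V ↪ V') {l : List V} {R : Finset V'} {x : V'}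
    (H : Hits (l.map e) R x) : ∃ y, x = e y := by
  have := H.2
  rw [List.getElem?_map, Option.map_eq_some_iff] at this
  obtain ⟨y, -, hy⟩ := this
  exact ⟨y, hy.symm⟩

section HitsLemmas

variable {V V' : Type} [DecidableEq V] [DecidableEq V']

theorem Hits.vis {l : List V} {R : Finset V} {x : V} (H : Hits l R x) : Vis l R :=
  ⟨H.1, (List.getElem?_eq_some_iff.1 H.2).1⟩

theorem vis_iff_exists_hits {l : List V} {R : Finset V} : Vis l R ↔ ∃ x, Hits l R x :=
  ⟨fun H => ⟨l[#R]'H.2, H.1, List.getElem?_eq_getElem H.2⟩, fun ⟨_, H⟩ => H.vis⟩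

theorem Hits.unique {l : List V} {R : Finset V} {x y : V} (H : Hits l R x) (H' : Hits l R y) :
    x = y := Option.some_injective _ (H.2.symm.trans H'.2)

theorem Hits.notMem {l : List V} (hl : l.Nodup) {R : Finset V} {x : V} (H : Hits l R x) :
    x ∉ R := by
  intro hx
  rw [← H.1, List.mem_toFinset, List.mem_take_iff_getElem] at hx
  obtain ⟨i, hi, hix⟩ := hx
  obtain ⟨hk, hkx⟩ := List.getElem?_eq_some_iff.1 H.2
  have := (hl.getElem_inj_iff (hi := by omega) (hj := hk)).1 (hix.trans hkx.symm)
  omega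

theorem Vis.subset {l : List V} {R : Finset V} (H : Vis l R) : R ⊆ l.toFinset := by
  intro x hx
  rw [← H.1, List.mem_toFinset] at hx
  exact List.mem_toFinset.2 (List.mem_of_mem_take hx)

theorem hits_append_left {a b : List V} {R : Finset V} {x : V} (h : #R < a.length) :
    Hits (a ++ b) R x ↔ Hits a R x := by
  unfold Hits
  rw [List.take_append_of_le_length h.le, List.getElem?_append_left h]

theorem vis_append_left {a b : List V} {R : Finset V} (h : #R < a.length) :
    Vis (a ++ b) R ↔ Vis a R := by
  simp only [vis_iff_exists_hits, hits_append_left h]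

theorem hits_append_right {a b : List V} (hab : (a ++ b).Nodup) {R : Finset V} {x : V}
    (h : a.length ≤ #R) :
    Hits (a ++ b) R x ↔ a.toFinset ⊆ R ∧ Hits b (R \ a.toFinset) x := by
  have hd : Disjoint a.toFinset b.toFinset := by
    rw [Finset.disjoint_left]
    intro y hy hy'
    exact (List.disjoint_of_nodup_append hab) (List.mem_toFinset.1 hy) (List.mem_toFinset.1 hy')
  have hca : #a.toFinset = a.length := List.toFinset_card_of_nodup hab.of_append_left
  have hdt : ∀ j, Disjoint (b.take j).toFinset a.toFinset := fun j =>
    hd.symm.mono_left (fun y hy => List.mem_toFinset.2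
      (List.mem_of_mem_take (List.mem_toFinset.1 hy)))
  have key : a.toFinset ⊆ R → #(R \ a.toFinset) = #R - a.length := fun hs => by
    rw [card_sdiff_of_subset hs, hca]
  unfold Hits
  rw [List.take_append, List.take_of_length_le h, List.toFinset_append,
    List.getElem?_append_right h]
  constructor
  · rintro ⟨h1, h2⟩
    have hs : a.toFinset ⊆ R := h1 ▸ subset_union_left
    refine ⟨hs, ?_, ?_⟩
    · rw [key hs]
      conv_rhs => rw [← h1]
      rw [union_sdiff_left, (hdt _).sdiff_eq_left]
    · rwa [key hs]
  · rintro ⟨hs, h1, h2⟩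
    rw [key hs] at h1 h2
    exact ⟨by rw [h1, union_sdiff_of_subset hs], h2⟩

theorem vis_append_right {a b : List V} (hab : (a ++ b).Nodup) {R : Finset V}
    (h : a.length ≤ #R) :
    Vis (a ++ b) R ↔ a.toFinset ⊆ R ∧ Vis b (R \ a.toFinset) := by
  simp only [vis_iff_exists_hits, hits_append_right hab h, exists_and_left]

theorem hits_map (e : V ↪ V') {l : List V} {R : Finset V} {x : V} :
    Hits (l.map e) (R.map e) (e x) ↔ Hits l R x := by
  unfold Hits
  rw [card_map, ← List.map_take, List.getElem?_map, Option.map_eq_some_iff]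
  have h1 : ((l.take #R).map e).toFinset = (l.take #R).toFinset.map e := by
    ext y
    simp only [List.mem_toFinset, List.mem_map, Finset.mem_map]
  rw [h1, (Finset.map_injective e).eq_iff]
  simp

theorem exists_of_vis_map (e : V ↪ V') {l : List V} {R : Finset V'} (H : Vis (l.map e) R) :
    ∃ S : Finset V, R = S.map e := by
  refine ⟨(l.take #R).toFinset, ?_⟩
  conv_lhs => rw [← H.1]
  rw [← List.map_take]
  ext y
  simp only [List.mem_toFinset, List.mem_map, Finset.mem_map]

theorem vis_map (e : V ↪ V') {l : List V} {R : Finset V} :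
    Vis (l.map e) (R.map e) ↔ Vis l R := by
  rw [vis_iff_exists_hits, vis_iff_exists_hits]
  constructor
  · rintro ⟨x, H⟩
    obtain ⟨y, rfl⟩ := exists_of_hits_map e H
    exact ⟨y, (hits_map e).1 H⟩
  · rintro ⟨y, H⟩
    exact ⟨e y, (hits_map e).2 H⟩

end HitsLemmas

/-! ### Hazard bounds for weighted families -/

section MassLemmas

variable {Ω Ω' A V V' : Type} [Fintype Ω] [Fintype Ω'] [Fintype A]

theorem mass_congr {w : Ω → ℝ} {l : Ω → List V} {l' : Ω → List V'} {Q : List V → Prop}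
    {Q' : List V' → Prop} (h : ∀ ω, Q (l ω) ↔ Q' (l' ω)) : mass w l Q = mass w l' Q' := by
  classical
  exact sum_congr rfl fun ω _ => if_congr (h ω) rfl rfl

theorem mass_nonneg {w : Ω → ℝ} (hw : ∀ ω, 0 ≤ w ω) (l : Ω → List V) (Q : List V → Prop) :
    0 ≤ mass w l Q := by
  unfold mass
  exact sum_nonneg fun ω _ => by split_ifs <;> simp [hw]

theorem mass_eq_zero {w : Ω → ℝ} {l : Ω → List V} {Q : List V → Prop} (h : ∀ ω, ¬ Q (l ω)) :
    mass w l Q = 0 := by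
  unfold mass
  exact sum_eq_zero fun ω _ => by simp [h ω]

theorem mass_mono {w : Ω → ℝ} (hw : ∀ ω, 0 ≤ w ω) {l : Ω → List V} {Q Q' : List V → Prop}
    (h : ∀ ω, Q (l ω) → Q' (l ω)) : mass w l Q ≤ mass w l Q' := by
  unfold mass
  refine sum_le_sum fun ω _ => ?_
  by_cases h1 : Q (l ω)
  · simp [h1, h ω h1]
  · simp only [h1, if_false]
    split_ifs <;> simp [hw]

theorem mass_mul_left (c : ℝ) (w : Ω → ℝ) (l : Ω → List V) (Q : List V → Prop) :
    mass (fun ω => c * w ω) l Q = c * mass w l Q := by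
  unfold mass
  rw [mul_sum]
  exact sum_congr rfl fun ω _ => by simp

theorem mass_equiv (e : A × Ω ≃ Ω') (w : Ω' → ℝ) (l : Ω' → List V) (Q : List V → Prop) :
    mass w l Q = ∑ a, mass (fun ω => w (e (a, ω))) (fun ω => l (e (a, ω))) Q := by
  unfold mass
  rw [← e.sum_comp, Fintype.sum_prod_type]

variable [DecidableEq V] [DecidableEq V']

theorem HazAt.mono {k : ℕ} {β β' : ℝ} {w : Ω → ℝ} {l : Ω → List V} (hw : ∀ ω, 0 ≤ w ω)
    (hβ : β ≤ β') (H : HazAt k β w l) : HazAt k β' w l := fun R hR x =>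
  (H R hR x).trans (mul_le_mul_of_nonneg_right hβ (mass_nonneg hw _ _))

theorem hazAt_of_one_le {k : ℕ} {β : ℝ} {w : Ω → ℝ} {l : Ω → List V} (hw : ∀ ω, 0 ≤ w ω)
    (hβ : 1 ≤ β) : HazAt k β w l := fun _ _ _ =>
  (mass_mono hw fun _ H => H.vis).trans (le_mul_of_one_le_left (mass_nonneg hw _ _) hβ)

theorem HazAt.scale {k : ℕ} {β c : ℝ} {w : Ω → ℝ} {l : Ω → List V} (hc : 0 ≤ c)
    (H : HazAt k β w l) : HazAt k β (fun ω => c * w ω) l := fun R hR x => by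
  rw [mass_mul_left, mass_mul_left, mul_left_comm]
  exact mul_le_mul_of_nonneg_left (H R hR x) hc

/-- The hazard inequality is linear in the weights, so it may be checked after freezing any
coordinate `a`. -/
theorem hazAt_of_fibers (e : A × Ω ≃ Ω') {k : ℕ} {β : ℝ} {w : Ω' → ℝ} {l : Ω' → List V}
    (H : ∀ a, HazAt k β (fun ω => w (e (a, ω))) (fun ω => l (e (a, ω)))) : HazAt k β w l :=
  fun R hR x => by
    rw [mass_equiv e, mass_equiv e, mul_sum]
    exact sum_le_sum fun a _ => H a R hR x

theorem HazAt.approx {k : ℕ} {β c₁ c₂ : ℝ} {w : Ω → ℝ} {w' : Ω' → ℝ} {l : Ω → List V}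
    {l' : Ω' → List V} (hβ : 0 ≤ β) (hc₁ : 0 < c₁) (hc₂ : 0 ≤ c₂)
    (h₁ : ∀ Q, c₁ * mass w l Q ≤ mass w' l' Q) (h₂ : ∀ Q, mass w' l' Q ≤ c₂ * mass w l Q)
    (H : HazAt k β w l) : HazAt k (β * (c₂ / c₁)) w' l' := fun R hR x => by
  calc mass w' l' (Hits · R x) ≤ c₂ * mass w l (Hits · R x) := h₂ _
    _ ≤ c₂ * (β * mass w l (Vis · R)) := mul_le_mul_of_nonneg_left (H R hR x) hc₂
    _ = β * (c₂ / c₁) * (c₁ * mass w l (Vis · R)) := by field_simp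
    _ ≤ _ := mul_le_mul_of_nonneg_left (h₁ _) (by positivity)

theorem HazAt.map {k : ℕ} {β : ℝ} {w : Ω → ℝ} {l : Ω → List V} (e : V ↪ V')
    (hw : ∀ ω, 0 ≤ w ω) (hβ : 0 ≤ β) (H : HazAt k β w l) :
    HazAt k β w (fun ω => (l ω).map e) := fun R hR x => by
  by_cases hx : ∃ y, x = e y
  · obtain ⟨y, rfl⟩ := hx
    by_cases hS : ∃ S : Finset V, R = S.map e
    · obtain ⟨S, rfl⟩ := hS
      rw [mass_congr (Q' := (Hits · S y)) (l' := l) (fun ω => hits_map e),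
        mass_congr (Q := (Vis · (S.map e))) (Q' := (Vis · S)) (l' := l) (fun ω => vis_map e)]
      exact H S (by simpa using hR) y
    · rw [mass_eq_zero fun ω Hω => hS (exists_of_vis_map e Hω.vis)]
      exact mul_nonneg hβ (mass_nonneg hw _ _)
  · rw [mass_eq_zero fun ω Hω => hx (exists_of_hits_map e Hω)]
    exact mul_nonneg hβ (mass_nonneg hw _ _)

theorem HazAt.append_left {k : ℕ} {β : ℝ} {w : Ω → ℝ} {a : Ω → List V} (b : Ω → List V)
    (hk : ∀ ω, k < (a ω).length) (H : HazAt k β w a) : HazAt k β w (fun ω => a ω ++ b ω) :=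
  fun R hR x => by
    rw [mass_congr (Q' := (Hits · R x)) (l' := a)
        (fun ω => hits_append_left (hR.symm ▸ hk ω)),
      mass_congr (Q := (Vis · R)) (Q' := (Vis · R)) (l' := a) (fun ω => vis_append_left (hR.symm ▸ hk ω))]
    exact H R hR x

/-- The first block may depend on `ω` in its order, but its set `S` is fixed; passing it reveals
nothing about `ω`, so the hazard of `b` is unaffected. -/
theorem HazAt.append_right {k : ℕ} {β : ℝ} {w : Ω → ℝ} {a b : Ω → List V} {S : Finset V}
    (hβ : 0 ≤ β) (hw : ∀ ω, 0 ≤ w ω) (hab : ∀ ω, (a ω ++ b ω).Nodup)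
    (ha : ∀ ω, (a ω).toFinset = S) (hk : #S ≤ k) (H : HazAt (k - #S) β w b) :
    HazAt k β w (fun ω => a ω ++ b ω) := fun R hR x => by
  have hlen : ∀ ω, (a ω).length ≤ #R := fun ω => by
    rw [← List.toFinset_card_of_nodup (hab ω).of_append_left, ha, hR]; exact hk
  by_cases hS : S ⊆ R
  · rw [mass_congr (Q' := (Hits · (R \ S) x)) (l' := b)
        (fun ω => (hits_append_right (hab ω) (hlen ω)).trans (by simp [ha, hS])),
      mass_congr (Q := (Vis · R)) (Q' := (Vis · (R \ S))) (l' := b)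
        (fun ω => (vis_append_right (hab ω) (hlen ω)).trans (by simp [ha, hS]))]
    exact H _ (by rw [card_sdiff_of_subset hS, hR]) x
  · rw [mass_eq_zero fun ω Hω => hS (ha ω ▸ ((hits_append_right (hab ω) (hlen ω)).1 Hω).1)]
    exact mul_nonneg hβ (mass_nonneg hw _ _)

end MassLemmas

/-! ### Exactly uniform families with at most `16^n` orderings -/

/-- An enumeration of the `m`-element set `S`. -/
noncomputable def enum {V : Type} {m : ℕ} (S : Finset V) (h : #S = m) : Fin m ↪ V :=
  (S.equivFinOfCardEq h).symm.toEmbedding.trans (Function.Embedding.subtype _)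

theorem map_enum {V : Type} {m : ℕ} (S : Finset V) (h : #S = m) :
    univ.map (enum S h) = S := by
  unfold enum
  rw [← Finset.map_map, Finset.map_univ_equiv]
  ext; simp

theorem enum_mem {V : Type} {m : ℕ} (S : Finset V) (h : #S = m) (i : Fin m) : enum S h i ∈ S := by
  simp [enum]

theorem exists_enum_eq {V : Type} {m : ℕ} (S : Finset V) (h : #S = m) {x : V} (hx : x ∈ S) :
    ∃ i, enum S h i = x := by
  rw [← map_enum S h] at hx
  simpa using hx

theorem exists_map_enum_eq {V : Type} [DecidableEq V] {m : ℕ} (S : Finset V) (h : #S = m)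
    {R : Finset V} (hR : R ⊆ S) : ∃ R' : Finset (Fin m), R'.map (enum S h) = R := by
  refine ⟨univ.filter fun i => enum S h i ∈ R, ?_⟩
  ext x
  simp only [mem_map, mem_filter, mem_univ, true_and]
  constructor
  · rintro ⟨i, hi, rfl⟩; exact hi
  · intro hx
    obtain ⟨i, rfl⟩ := exists_enum_eq S h (hR hx)
    exact ⟨i, hx, rfl⟩

theorem toFinset_eq_univ {m : ℕ} {l : List (Fin m)} (hl : l.Nodup) (hm : l.length = m) :
    l.toFinset = univ := by
  apply eq_univ_of_card
  rw [List.toFinset_card_of_nodup hl, hm, Fintype.card_fin]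

theorem toFinset_map_enum {V : Type} [DecidableEq V] {m : ℕ} (S : Finset V) (h : #S = m)
    {l : List (Fin m)} (hl : l.Nodup) (hm : l.length = m) :
    (l.map (enum S h)).toFinset = S := by
  conv_rhs => rw [← map_enum S h, ← toFinset_eq_univ hl hm]
  ext
  simp only [List.mem_toFinset, List.mem_map, Finset.mem_map]

/-- In the family `l`, all pairs of a `k`-set `R` and an element `x ∉ R` are equally often such
that `R` comes first and is followed by `x`. -/
def ExactAt {Ω V : Type} [Fintype Ω] [DecidableEq V] (k : ℕ) (l : Ω → List V) : Prop :=
  ∃ c : ℝ, ∀ R : Finset V, #R = k → ∀ x, x ∉ R → mass (fun _ => 1) l (Hits · R x) = c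

section

variable {Ω V : Type} [Fintype V] [DecidableEq V]

theorem mass_vis [Fintype Ω] (w : Ω → ℝ) (l : Ω → List V) (R : Finset V) :
    mass w l (Vis · R) = ∑ x, mass w l (Hits · R x) := by
  unfold mass
  rw [sum_comm]
  refine sum_congr rfl fun ω _ => ?_
  by_cases h : Vis (l ω) R
  · obtain ⟨x, hx⟩ := vis_iff_exists_hits.1 h
    rw [if_pos h, sum_eq_single x, if_pos hx]
    · intro y _ hy
      exact if_neg fun hy' => hy (hy'.unique hx)
    · simp
  · rw [if_neg h]
    exact (sum_eq_zero fun x _ => if_neg fun hx => h hx.vis).symm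

theorem ExactAt.hazAt [Fintype Ω] {k : ℕ} {l : Ω → List V} (hl : ∀ ω, (l ω).Nodup) (H : ExactAt k l)
    (hk : k < Fintype.card V) : HazAt k (1 / ((Fintype.card V : ℝ) - k)) (fun _ => 1) l := by
  obtain ⟨c, hc⟩ := H
  intro R hR x
  have h0 : ∀ y ∈ R, mass (fun _ => 1) l (Hits · R y) = 0 := fun y hy =>
    mass_eq_zero fun ω hω => hω.notMem (hl ω) hy
  have hpos : (0 : ℝ) < (Fintype.card V : ℝ) - k := by
    have : (k : ℝ) < Fintype.card V := by exact_mod_cast hk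
    linarith
  have hv : mass (fun _ => 1) l (Vis · R) = ((Fintype.card V : ℝ) - k) * c := by
    rw [mass_vis, ← sum_compl_add_sum R, sum_eq_zero h0, add_zero,
      sum_congr rfl fun y hy => hc R hR y (mem_compl.1 hy), sum_const, card_compl, hR,
      nsmul_eq_mul, Nat.cast_sub hk.le]
  by_cases hx : x ∈ R
  · rw [h0 x hx]
    exact mul_nonneg (by positivity) (mass_nonneg (fun _ => zero_le_one) _ _)
  · rw [hv, hc R hR x hx]
    field_simp
    rfl

/-- Choose an `m`-set, list it along `a` and continue along `b`. -/
noncomputable def splitList {m n : ℕ} (hn : Fintype.card V = n) (a : Ω → List (Fin m))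
    (b : Ω → List (Fin (n - m))) (i : {S : Finset V // #S = m} × Ω) : List V :=
  (a i.2).map (enum i.1.1 i.1.2) ++
    (b i.2).map (enum (m := n - m) i.1.1ᶜ (by rw [card_compl, i.1.2, hn]))

theorem exactAt_map_enum [Fintype Ω] {m k : ℕ} {a : Ω → List (Fin m)}
    (hk : k < m) (H : ExactAt k a) :
    ExactAt k (fun i : {S : Finset V // #S = m} × Ω => (a i.2).map (enum i.1.1 i.1.2)) := by
  classical
  obtain ⟨c, hc⟩ := H
  -- The binomial coefficient counts the `m`-sets containing `R` and `x`.
  refine ⟨((Fintype.card V - (k + 1)).choose (m - (k + 1)) : ℝ) * c, fun R hR x hx => ?_⟩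
  rw [mass_equiv (Equiv.refl _)]
  have hT : #(insert x R) = k + 1 := by rw [card_insert_of_notMem hx, hR]
  have key : ∀ S : {S : Finset V // #S = m},
      mass (fun _ : Ω => (1 : ℝ)) (fun ω => (a ω).map (enum S.1 S.2)) (Hits · R x) =
        if insert x R ⊆ S.1 then c else 0 := by
    intro S
    split_ifs with hs
    · obtain ⟨x', rfl⟩ := exists_enum_eq S.1 S.2 (hs (mem_insert_self _ _))
      obtain ⟨R', rfl⟩ := exists_map_enum_eq S.1 S.2 ((subset_insert _ _).trans hs)
      rw [mass_congr (Q' := (Hits · R' x')) (l' := a) (fun ω => hits_map _)]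
      exact hc R' (by simpa using hR) x' (by simpa using hx)
    · refine mass_eq_zero fun ω hω => hs ?_
      obtain ⟨y, rfl⟩ := exists_of_hits_map _ hω
      obtain ⟨R', rfl⟩ := exists_of_vis_map _ hω.vis
      rw [insert_subset_iff]
      refine ⟨enum_mem _ _ _, fun z hz => ?_⟩
      obtain ⟨i, -, rfl⟩ := mem_map.1 hz
      exact enum_mem _ _ _
  refine (sum_congr rfl fun S _ => key S).trans ?_
  rw [← sum_filter, sum_const, nsmul_eq_mul, ← hT, ← card_univ,
    ← card_filter_powersetCard_subset _ _ m (subset_univ _) (by omega)]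
  congr 2
  refine card_bij (fun S _ => S.1) ?_ ?_ ?_
  · intro S hS
    simp only [mem_filter, mem_univ, true_and, mem_powersetCard, subset_univ] at hS ⊢
    exact ⟨S.2, hS⟩
  · intro S _ S' _ h; exact Subtype.ext h
  · intro S hS
    simp only [mem_filter, mem_powersetCard, subset_univ, true_and] at hS
    exact ⟨⟨S, hS.1⟩, by simpa using hS.2, rfl⟩

theorem splitList_nodup {m n : ℕ} (hn : Fintype.card V = n) {a : Ω → List (Fin m)}
    {b : Ω → List (Fin (n - m))} (ha : ∀ ω, (a ω).Nodup) (hb : ∀ ω, (b ω).Nodup)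
    (i : {S : Finset V // #S = m} × Ω) : (splitList hn a b i).Nodup := by
  refine List.Nodup.append ((ha _).map (enum _ _).injective) ((hb _).map (enum _ _).injective) ?_
  intro x hx hx'
  obtain ⟨y, -, rfl⟩ := List.mem_map.1 hx
  obtain ⟨z, -, hz⟩ := List.mem_map.1 hx'
  have h1 := enum_mem i.1.1 i.1.2 y
  rw [← hz] at h1
  exact mem_compl.1 (enum_mem _ _ z) h1

/-- Both halves use the same `ω`: once the first block is complete, only its set `S` matters, and
each of the `k.choose m` sets `S ⊆ R` contributes the same count from `b`. -/
theorem exactAt_splitList [Fintype Ω] {m n k : ℕ} (hn : Fintype.card V = n)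
    {a : Ω → List (Fin m)} {b : Ω → List (Fin (n - m))} (ha : ∀ ω, (a ω).Nodup)
    (hb : ∀ ω, (b ω).Nodup) (ham : ∀ ω, (a ω).length = m)
    (Ha : k < m → ExactAt k a) (Hb : m ≤ k → ExactAt (k - m) b) :
    ExactAt k (splitList hn a b) := by
  classical
  rcases lt_or_ge k m with hk | hk
  · obtain ⟨c, hc⟩ := exactAt_map_enum (V := V) hk (Ha hk)
    refine ⟨c, fun R hR x hx => ?_⟩
    rw [← hc R hR x hx]
    refine mass_congr fun i => hits_append_left ?_
    rw [List.length_map, ham, hR]; exact hk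
  · obtain ⟨c, hc⟩ := Hb hk
    refine ⟨(k.choose m : ℝ) * c, fun R hR x hx => ?_⟩
    rw [mass_equiv (Equiv.refl _)]
    have key : ∀ S : {S : Finset V // #S = m},
        mass (fun _ : Ω => (1 : ℝ)) (fun ω => splitList hn a b (S, ω)) (Hits · R x) =
          if S.1 ⊆ R then c else 0 := by
      intro S
      have hH : ∀ ω, Hits (splitList hn a b (S, ω)) R x ↔ S.1 ⊆ R ∧
          Hits ((b ω).map (enum (m := n - m) S.1ᶜ (by rw [card_compl, S.2, hn]))) (R \ S.1) x := by
        intro ω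
        have := hits_append_right (splitList_nodup hn ha hb (S, ω)) (R := R) (x := x)
          (by rw [List.length_map, ham, hR]; exact hk)
        rwa [toFinset_map_enum _ _ (ha ω) (ham ω)] at this
      split_ifs with hs
      · obtain ⟨x', hx'⟩ := exists_enum_eq (m := n - m) S.1ᶜ (by rw [card_compl, S.2, hn])
          (mem_compl.2 fun h => hx (hs h))
        obtain ⟨R', hR'⟩ := exists_map_enum_eq (m := n - m) S.1ᶜ (by rw [card_compl, S.2, hn])
          (R := R \ S.1) (fun y hy => by simp at hy ⊢; exact hy.2)
        rw [mass_congr (Q' := (Hits · R' x')) (l' := b) (fun ω => by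
          rw [hH, ← hx', ← hR', hits_map]; simp [hs])]
        refine hc R' ?_ x' ?_
        · rw [← card_map, hR', card_sdiff_of_subset hs, hR, S.2]
        · intro h
          have := mem_map_of_mem (enum (m := n - m) S.1ᶜ (by rw [card_compl, S.2, hn])) h
          rw [hR', hx'] at this
          exact hx (mem_sdiff.1 this).1
      · exact mass_eq_zero fun ω hω => hs ((hH ω).1 hω).1
    refine (sum_congr rfl fun S _ => key S).trans ?_
    rw [← sum_filter, sum_const, nsmul_eq_mul, ← hR, ← card_powersetCard]
    congr 2
    refine card_bij (fun S _ => S.1) ?_ ?_ ?_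
    · intro S hS
      simp only [mem_filter, mem_univ, true_and, mem_powersetCard] at hS ⊢
      exact ⟨hS, S.2⟩
    · intro S _ S' _ h; exact Subtype.ext h
    · intro S hS
      simp only [mem_powersetCard] at hS
      exact ⟨⟨S, hS.2⟩, by simpa using hS.1, rfl⟩

end

/-- There are at most `N` orderings of `Fin n` among which every set `R` of every size `k < n` is
followed by every `x ∉ R` equally often. -/
def ExactFamily (n N : ℕ) : Prop :=
  ∃ (Ω : Type) (_ : Fintype Ω) (l : Ω → List (Fin n)), Nonempty Ω ∧ (∀ ω, (l ω).Nodup) ∧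
    (∀ ω, (l ω).length = n) ∧ Function.Injective l ∧ (∀ k < n, ExactAt k l) ∧
    Fintype.card Ω ≤ N

theorem exactFamily_of_split {n m N : ℕ} (hm : m ≤ n) {Ω : Type} [Fintype Ω] [Nonempty Ω]
    {a : Ω → List (Fin m)} {b : Ω → List (Fin (n - m))}
    (ha : ∀ ω, (a ω).Nodup) (hb : ∀ ω, (b ω).Nodup) (ham : ∀ ω, (a ω).length = m)
    (hbm : ∀ ω, (b ω).length = n - m) (hinj : Function.Injective b)
    (Ha : ∀ k < m, ExactAt k a) (Hb : ∀ k < n - m, ExactAt k b) (hN : Fintype.card Ω ≤ N) :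
    ExactFamily n (n.choose m * N) := by
  have hn : Fintype.card (Fin n) = n := Fintype.card_fin n
  refine ⟨{S : Finset (Fin n) // #S = m} × Ω, inferInstance, splitList hn a b, ?_,
    splitList_nodup hn ha hb, ?_, ?_, ?_, ?_⟩
  · obtain ⟨S, -, hS⟩ := exists_subset_card_eq (s := (univ : Finset (Fin n))) (n := m)
      (by simpa using hm)
    exact ⟨⟨⟨S, hS⟩, Classical.arbitrary Ω⟩⟩
  · intro i
    unfold splitList
    rw [List.length_append, List.length_map, List.length_map, ham, hbm]
    omega
  · rintro ⟨⟨S, hS⟩, ω⟩ ⟨⟨S', hS'⟩, ω'⟩ h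
    obtain ⟨h1, h2⟩ := List.append_inj h (by simp [ham])
    have h3 : S = S' := by
      have := congrArg List.toFinset h1
      rwa [toFinset_map_enum _ _ (ha _) (ham _), toFinset_map_enum _ _ (ha _) (ham _)] at this
    subst h3
    have : ω = ω' := hinj ((enum _ _).injective.list_map h2)
    rw [this]
  · intro k hk
    exact exactAt_splitList hn ha hb ham (fun h => Ha k h) (fun h => Hb _ (by omega))
  · rw [Fintype.card_prod, Fintype.card_finset_len, hn]
    exact Nat.mul_le_mul_left _ hN

/-- Sharing `ω` between the halves multiplies the size by a binomial coefficient instead of squaring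
it, which keeps `exactFamily` exponential in `n`. -/
theorem ExactFamily.double {m N : ℕ} (H : ExactFamily m N) : ExactFamily (2 * m) (4 ^ m * N) := by
  obtain ⟨Ω, _, l, _, h1, h2, h3, h4, h5⟩ := H
  have e : 2 * m - m = m := by omega
  have key : ∃ b : Ω → List (Fin (2 * m - m)), (∀ ω, (b ω).Nodup) ∧
      (∀ ω, (b ω).length = 2 * m - m) ∧ Function.Injective b ∧ ∀ k < 2 * m - m, ExactAt k b := by
    rw [e]; exact ⟨l, h1, h2, h3, h4⟩
  obtain ⟨b, b1, b2, b3, b4⟩ := key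
  obtain ⟨Ω', i1, l', j1, j2, j3, j4, j5, j6⟩ :=
    exactFamily_of_split (n := 2 * m) (by omega) h1 b1 h2 b2 b3 h4 b4 h5
  refine ⟨Ω', i1, l', j1, j2, j3, j4, j5, j6.trans (Nat.mul_le_mul_right _ ?_)⟩
  have := Nat.choose_le_two_pow (2 * m) m
  rwa [pow_mul] at this

theorem ExactFamily.succ {n N : ℕ} (H : ExactFamily n N) : ExactFamily (n + 1) ((n + 1) * N) := by
  obtain ⟨Ω, _, l, _, h1, h2, h3, h4, h5⟩ := H
  have := exactFamily_of_split (n := n + 1) (m := 1) (a := fun _ : Ω => [0]) (b := l) (by omega)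
    (by simp) h1 (by simp) h2 h3 ?_ h4 h5
  · simpa using this
  · intro k hk
    refine ⟨Fintype.card Ω, fun R hR x hx => ?_⟩
    obtain rfl : k = 0 := by omega
    obtain rfl : R = ∅ := by simpa using hR
    obtain rfl : x = 0 := Subsingleton.elim _ _
    simp [mass, Hits]

theorem ExactFamily.mono {n N N' : ℕ} (h : N ≤ N') (H : ExactFamily n N) : ExactFamily n N' := by
  obtain ⟨Ω, i, l, j1, j2, j3, j4, j5, j6⟩ := H
  exact ⟨Ω, i, l, j1, j2, j3, j4, j5, j6.trans h⟩

theorem exactFamily (n : ℕ) : ExactFamily n (16 ^ n) := by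
  induction n using Nat.strong_induction_on with
  | _ n ih =>
    rcases Nat.eq_zero_or_pos n with rfl | hn
    · refine ⟨Unit, inferInstance, fun _ => [], inferInstance, by simp, by simp, ?_, by simp,
        by simp⟩
      intro a b _; rfl
    obtain ⟨m, rfl | rfl⟩ := Nat.even_or_odd' n
    · refine (ih m (by omega)).double.mono ?_
      calc 4 ^ m * 16 ^ m ≤ 16 ^ m * 16 ^ m := by gcongr; norm_num
        _ = _ := by ring
    · refine (ih m (by omega)).double.succ.mono ?_
      have h : 2 * m + 1 ≤ 4 ^ m * 16 := by
        have := (Nat.lt_pow_self (n := m) (a := 4) (by norm_num))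
        omega
      calc (2 * m + 1) * (4 ^ m * 16 ^ m) ≤ (4 ^ m * 16) * (4 ^ m * 16 ^ m) := by gcongr
        _ = 16 ^ (2 * m + 1) := by
          rw [pow_succ, pow_mul, show (16 : ℕ) ^ 2 = 4 * 4 * 16 by norm_num, mul_pow, mul_pow]
          ring

/-! ### Rounding a law to a uniform seed -/

theorem exists_rounding {ι : Type} [Fintype ι] [DecidableEq ι] (p : ι → ℝ) (hp : ∀ i, 0 ≤ p i)
    (hs : ∑ i, p i = 1) (M : ℕ) :
    ∃ f : Fin M → ι, ∀ i, |(#{t | f t = i} : ℝ) - M * p i| ≤ 1 := by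
  classical
  have hf : ∀ i, (⌊M * p i⌋₊ : ℝ) ≤ M * p i := fun i =>
    Nat.floor_le (mul_nonneg (Nat.cast_nonneg _) (hp i))
  have h1 : ∑ i, ⌊M * p i⌋₊ ≤ M := by
    have : ((∑ i, ⌊M * p i⌋₊ : ℕ) : ℝ) ≤ M := by
      push_cast
      calc _ ≤ ∑ i, M * p i := sum_le_sum fun i _ => hf i
        _ = M := by rw [← mul_sum, hs, mul_one]
    exact_mod_cast this
  have h2 : M - ∑ i, ⌊M * p i⌋₊ ≤ #(univ : Finset ι) := by
    have : (M : ℝ) ≤ ((∑ i, (⌊M * p i⌋₊ + 1) : ℕ) : ℝ) := by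
      push_cast
      calc (M : ℝ) = ∑ i, M * p i := by rw [← mul_sum, hs, mul_one]
        _ ≤ _ := sum_le_sum fun i _ => (Nat.lt_floor_add_one _).le
    have : M ≤ ∑ i, (⌊M * p i⌋₊ + 1) := by exact_mod_cast this
    rw [sum_add_distrib] at this
    simp at this ⊢
    omega
  obtain ⟨s, -, hsc⟩ := exists_subset_card_eq h2
  -- Round every `M * p i` down, then hand the missing units to distinct indices.
  let c : ι → ℕ := fun i => ⌊M * p i⌋₊ + if i ∈ s then 1 else 0
  have hc : ∑ i, c i = M := by
    simp only [c, sum_add_distrib, sum_ite_mem, univ_inter, sum_const, smul_eq_mul, mul_one, hsc]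
    omega
  have e : Fin M ≃ Σ i, Fin (c i) := Fintype.equivOfCardEq (by simp [hc])
  refine ⟨fun t => (e t).1, fun i => ?_⟩
  have hcard : #{t | (e t).1 = i} = c i := by
    rw [← Fintype.card_fin (c i), ← card_univ]
    symm
    refine card_bij (fun j _ => e.symm ⟨i, j⟩) (by simp) ?_ ?_
    · intro a _ b _ h
      simpa using h
    · intro t ht
      simp only [mem_filter, mem_univ, true_and] at ht
      subst ht
      exact ⟨(e t).2, mem_univ _, by simp⟩
  rw [hcard, abs_le]
  have := hf i
  have := Nat.lt_floor_add_one (M * p i)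
  simp only [c]
  push_cast
  split_ifs <;> constructor <;> linarith

/-- An additive error of 1 is a relative error `δ` as soon as every expected count is at least
`1/δ`. -/
theorem exists_rounding_mul {ι : Type} [Fintype ι] [DecidableEq ι] (w : ι → ℝ)
    (hw : ∀ i, 0 < w i) [Nonempty ι] {δ : ℝ} {M : ℕ} (hM : ∀ i, ∑ j, w j ≤ δ * M * w i) :
    ∃ f : Fin M → ι, ∀ i, (1 - δ) * M * w i ≤ #{t | f t = i} * ∑ j, w j ∧
      #{t | f t = i} * ∑ j, w j ≤ (1 + δ) * M * w i := by
  have hpos : 0 < ∑ j, w j := sum_pos (fun i _ => hw i) univ_nonempty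
  obtain ⟨f, hf⟩ := exists_rounding (fun i => w i / ∑ j, w j)
    (fun i => div_nonneg (hw i).le hpos.le) (by rw [← sum_div, div_self hpos.ne']) M
  refine ⟨f, fun i => ?_⟩
  have h := abs_le.1 (hf i)
  have e : (M : ℝ) * (w i / ∑ j, w j) * ∑ j, w j = M * w i := by field_simp
  have := hM i
  constructor <;> nlinarith [mul_le_mul_of_nonneg_right h.1 hpos.le,
    mul_le_mul_of_nonneg_right h.2 hpos.le]

theorem mass_le_mass {Ω V : Type} [Fintype Ω] {w w' : Ω → ℝ} (h : ∀ ω, w ω ≤ w' ω) (l : Ω → List V) (Q : List V → Prop) :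
    mass w l Q ≤ mass w' l Q := by
  unfold mass
  refine sum_le_sum fun ω _ => ?_
  split_ifs
  exacts [h ω, le_rfl]

section Coupling

variable {I U Ω V : Type} [Fintype I] [DecidableEq I]

/-- The total weight of the fiber of `surv` over `u`. -/
noncomputable def fiberMass [DecidableEq U] (surv : I → U) (ν : I → ℝ) (u : U) : ℝ :=
  ∑ i, if surv i = u then ν i else 0

/-- Inside each fiber of `surv` the conditional law of `ν` is rounded. A fiber weighs no more than
the whole, so one `M` serves all fibers. -/
theorem exists_coupling [DecidableEq U] (surv : I → U) (ν : I → ℝ) (hν : ∀ i, 0 < ν i)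
    (hsurj : Function.Surjective surv) {δ : ℝ} {M : ℕ}
    (hM : ∀ i, ∑ j, ν j ≤ δ * M * ν i) :
    ∃ f : U → Fin M → I, (∀ u t, surv (f u t) = u) ∧
      ∀ i, (1 - δ) * M * ν i ≤ #{t | f (surv i) t = i} * fiberMass surv ν (surv i) ∧
        #{t | f (surv i) t = i} * fiberMass surv ν (surv i) ≤ (1 + δ) * M * ν i := by
  have key : ∀ u, ∃ f : Fin M → {i // surv i = u}, ∀ i : {i // surv i = u},
      (1 - δ) * M * ν i ≤ #{t | f t = i} * fiberMass surv ν u ∧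
        #{t | f t = i} * fiberMass surv ν u ≤ (1 + δ) * M * ν i := by
    intro u
    have hF : fiberMass surv ν u = ∑ j : {i // surv i = u}, ν j := by
      unfold fiberMass
      rw [← sum_filter]
      exact sum_subtype _ (by simp) _
    obtain ⟨i₀, hi₀⟩ := hsurj u
    have : Nonempty {i // surv i = u} := ⟨⟨i₀, hi₀⟩⟩
    rw [hF]
    refine exists_rounding_mul (fun i : {i // surv i = u} => ν i) (fun i => hν i) fun i => ?_
    refine le_trans ?_ (hM i)
    rw [← hF]
    unfold fiberMass
    refine sum_le_sum fun j _ => ?_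
    split_ifs
    exacts [le_rfl, (hν j).le]
  choose f hf using key
  refine ⟨fun u t => (f u t).1, fun u t => (f u t).2, fun i => ?_⟩
  have := hf (surv i) ⟨i, rfl⟩
  simpa only [Subtype.ext_iff] using this

theorem mass_coupling [Fintype U] [Fintype Ω] {M : ℕ} (f : U → Fin M → I) (surv : I → U)
    (hf : ∀ u t, surv (f u t) = u) (μ : U → ℝ) (l : I → Ω → List V) (Q : List V → Prop) :
    mass (fun j : U × (Ω × Fin M) => μ j.1) (fun j => l (f j.1 j.2.2) j.2.1) Q =
      mass (fun j : I × Ω => #{t | f (surv j.1) t = j.1} * μ (surv j.1))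
        (fun j => l j.1 j.2) Q := by
  classical
  unfold mass
  rw [Fintype.sum_prod_type, Fintype.sum_prod_type]
  simp only [Fintype.sum_prod_type]
  have h : ∀ u, ∑ s : Ω, ∑ t : Fin M, (if Q (l (f u t) s) then μ u else 0) =
      ∑ i : I, ∑ s : Ω, if Q (l i s) then (#{t | f u t = i} : ℝ) * μ u else 0 := by
    intro u
    conv_rhs => rw [sum_comm]
    refine sum_congr rfl fun s _ => ?_
    rw [← sum_fiberwise (s := univ) (g := fun t => f u t)]
    refine sum_congr rfl fun i _ => ?_
    rw [sum_congr rfl (g := fun _ => if Q (l i s) then μ u else 0), sum_const, nsmul_eq_mul]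
    · split_ifs <;> simp
    · intro t ht
      rw [(mem_filter.1 ht).2]
  rw [sum_congr rfl fun u _ => h u, sum_comm]
  refine sum_congr rfl fun i _ => ?_
  rw [sum_eq_single (surv i)]
  · intro u _ hu
    refine sum_eq_zero fun s _ => ?_
    have : #{t | f u t = i} = 0 := by
      rw [card_eq_zero, filter_eq_empty_iff]
      rintro t - rfl
      exact hu (hf u t).symm
    simp [this]
  · simp

/-- Drawing `u` and then `i` from the rounded conditional law changes each weight `ν i` by a factor
between `1 - δ` and `1 + δ`, up to the common scale `M`; hazards are ratios and lose at most the
quotient. -/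
theorem HazAt.coupling [Fintype U] [Fintype Ω] [DecidableEq V] {k M : ℕ} {β δ : ℝ} (hβ : 0 ≤ β) (hδ : 0 ≤ δ)
    (hδ1 : δ < 1) (hM : 0 < M) {f : U → Fin M → I} {surv : I → U} (hf : ∀ u t, surv (f u t) = u)
    {μ : U → ℝ} {ν : I → ℝ}
    (h : ∀ i, (1 - δ) * M * ν i ≤ #{t | f (surv i) t = i} * μ (surv i) ∧
        #{t | f (surv i) t = i} * μ (surv i) ≤ (1 + δ) * M * ν i) {l : I → Ω → List V}
    (H : HazAt k β (fun j : I × Ω => ν j.1) (fun j => l j.1 j.2)) :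
    HazAt k (β * ((1 + δ) / (1 - δ))) (fun j : U × (Ω × Fin M) => μ j.1)
      (fun j => l (f j.1 j.2.2) j.2.1) := by
  have hM' : (0 : ℝ) < M := by exact_mod_cast hM
  have h1 : 0 < 1 - δ := by linarith
  have := H.approx (c₁ := (1 - δ) * M) (c₂ := (1 + δ) * M)
    (w' := fun j : U × (Ω × Fin M) => μ j.1) (l' := fun j => l (f j.1 j.2.2) j.2.1) hβ
    (by positivity) (by positivity) (fun Q => ?_) (fun Q => ?_)
  · rwa [mul_div_mul_right _ _ hM'.ne'] at this
  · rw [mass_coupling f surv hf μ l Q, ← mass_mul_left]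
    exact mass_le_mass (fun j : I × Ω => (h j.1).1) _ Q
  · rw [mass_coupling f surv hf μ l Q, ← mass_mul_left]
    exact mass_le_mass (fun j : I × Ω => (h j.1).2) _ Q

end Coupling

/-! ### Merging two copies: hazards and survivors -/

/-- A random half of `2h` points avoids `a` given points with probability at least `16^(-a)`. For `h
≤ 2a` this is the bound `4^h`; otherwise each further point costs a factor `(m+1)/(m+1-h)`, which is
bounded. -/
theorem choose_two_mul_le {h a : ℕ} (ha : a ≤ h) :
    (2 * h).choose h ≤ 16 ^ a * (2 * h - a).choose h := by
  rcases le_or_gt h (2 * a) with h1 | h1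
  · have h2 : 1 ≤ (2 * h - a).choose h := Nat.choose_pos (by omega)
    calc (2 * h).choose h ≤ 2 ^ (2 * h) := Nat.choose_le_two_pow _ _
      _ ≤ 2 ^ (4 * a) := Nat.pow_le_pow_right (by norm_num) (by omega)
      _ = 16 ^ a * 1 := by rw [pow_mul]; norm_num
      _ ≤ _ := Nat.mul_le_mul_left _ h2
  · clear ha
    induction a with
    | zero => simp
    | succ a ih =>
      refine (ih (by omega)).trans ?_
      rw [pow_succ, mul_assoc]
      refine Nat.mul_le_mul_left _ ?_
      obtain ⟨m, hm⟩ : ∃ m, 2 * h - a = m + 1 := ⟨2 * h - a - 1, by omega⟩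
      have hm' : 2 * h - (a + 1) = m := by omega
      rw [hm, hm']
      have h3 := Nat.choose_mul_succ_eq m h
      have h4 : m + 1 ≤ 16 * (m + 1 - h) := by omega
      refine Nat.le_of_mul_le_mul_right (c := m + 1 - h) ?_ (by omega)
      rw [← h3]
      calc _ ≤ m.choose h * (16 * (m + 1 - h)) := Nat.mul_le_mul_left _ h4
        _ = _ := by ring

/-- The subsets of size `h`. -/
abbrev FixedCard (V : Type) (h : ℕ) : Type := {u : Finset V // #u = h}

theorem hazAt_of_length_le {Ω V : Type} [Fintype Ω] [DecidableEq V] {k : ℕ} {β : ℝ} {w : Ω → ℝ}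
    {l : Ω → List V} (hβ : 0 ≤ β) (hw : ∀ ω, 0 ≤ w ω) (hl : ∀ ω, (l ω).length ≤ k) :
    HazAt k β w l := fun R hR x => by
  rw [mass_eq_zero fun ω hω => ?_]
  · exact mul_nonneg hβ (mass_nonneg hw _ _)
  · have := hω.vis.2
    have := hl ω
    omega

section Merge

variable {V X Ω : Type} {h : ℕ}

/-- The union of a survivor set in each of the two copies of `V`. -/
def pool (u₁ u₂ : FixedCard V h) : Finset (V ⊕ V) := u₁.1.disjSum u₂.1

theorem card_pool (u₁ u₂ : FixedCard V h) : #(pool u₁ u₂) = 2 * h := by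
  rw [pool, card_disjSum, u₁.2, u₂.2, two_mul]

/-- List the elements of an `h`-subset of the pool. -/
noncomputable def remList (a : X → List (Fin h)) (u₁ u₂ : FixedCard V h)
    (τ : FixedCard (Fin (2 * h)) h × X) : List (V ⊕ V) :=
  ((a τ.2).map (enum τ.1.1 τ.1.2)).map (enum (pool u₁ u₂) (card_pool u₁ u₂))

/-- List `V` twice up to the survivors of the two copies, then half of the survivors. -/
noncomputable def mergeList (a : X → List (Fin h)) (lst : FixedCard V h → Ω → List V)
    (i : FixedCard V h × FixedCard V h × (FixedCard (Fin (2 * h)) h × X)) (s : Ω) : List (V ⊕ V) :=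
  ((lst i.1 s).map Function.Embedding.inl ++ (lst i.2.1 s).map Function.Embedding.inr) ++
    remList a i.1 i.2.1 i.2.2

theorem remList_subset_pool (a : X → List (Fin h)) (u₁ u₂ : FixedCard V h)
    (τ : FixedCard (Fin (2 * h)) h × X) {x : V ⊕ V} (hx : x ∈ remList a u₁ u₂ τ) :
    x ∈ pool u₁ u₂ := by
  obtain ⟨y, -, rfl⟩ := List.mem_map.1 hx
  exact enum_mem _ _ _

variable [DecidableEq V]

/-- The half of the pool that is left. -/
noncomputable def surv (i : FixedCard V h × FixedCard V h × (FixedCard (Fin (2 * h)) h × X)) : FixedCard (V ⊕ V) h :=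
  ⟨pool i.1 i.2.1 \ i.2.2.1.1.map (enum (pool i.1 i.2.1) (card_pool i.1 i.2.1)), by
    rw [card_sdiff_of_subset, card_pool, card_map, i.2.2.1.2]
    · omega
    · intro x hx
      obtain ⟨y, -, rfl⟩ := mem_map.1 hx
      exact enum_mem _ _ _⟩

theorem toFinset_remList {a : X → List (Fin h)} (ha : ∀ x, (a x).Nodup)
    (hah : ∀ x, (a x).length = h) (u₁ u₂ : FixedCard V h) (τ : FixedCard (Fin (2 * h)) h × X) :
    (remList a u₁ u₂ τ).toFinset = τ.1.1.map (enum (pool u₁ u₂) (card_pool u₁ u₂)) := by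
  conv_rhs => rw [← toFinset_map_enum τ.1.1 τ.1.2 (ha τ.2) (hah τ.2)]
  unfold remList
  ext
  simp only [List.mem_toFinset, List.mem_map, Finset.mem_map]

theorem hazAt_remList [Fintype X] {a : X → List (Fin h)} (ha : ∀ x, (a x).Nodup)
    (hah : ∀ x, (a x).length = h) (hX : ∀ k < h, ExactAt k a) {β : ℝ} (hβ : 0 ≤ β)
    (hβh : 1 ≤ β * h) (u₁ u₂ : FixedCard V h) (k : ℕ) :
    HazAt k β (fun _ => 1) (remList a u₁ u₂) := by
  rcases lt_or_ge k h with hk | hk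
  · refine HazAt.map _ (fun _ => zero_le_one) hβ ?_
    have := (exactAt_map_enum (V := Fin (2 * h)) hk (hX k hk)).hazAt
      (fun i => (ha _).map (enum _ _).injective) (by rw [Fintype.card_fin]; omega)
    refine this.mono (fun _ => zero_le_one) ?_
    rw [Fintype.card_fin]
    have h1 : (k : ℝ) ≤ h := by exact_mod_cast hk.le
    have h2 : (0 : ℝ) < h := by exact_mod_cast (by omega : 0 < h)
    push_cast
    rw [div_le_iff₀ (by linarith)]
    nlinarith
  · refine hazAt_of_length_le hβ (fun _ => zero_le_one) fun τ => ?_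
    unfold remList
    rwa [List.length_map, List.length_map, hah]

variable [Fintype V]

theorem toFinset_append_lists {lst : FixedCard V h → Ω → List V}
    (hlst : ∀ u s, (lst u s).toFinset = u.1ᶜ) (u₁ u₂ : FixedCard V h) (s : Ω) :
    ((lst u₁ s).map Function.Embedding.inl ++
      (lst u₂ s).map Function.Embedding.inr : List (V ⊕ V)).toFinset = (pool u₁ u₂)ᶜ := by
  have h1 : ∀ u s x, x ∈ lst u s ↔ x ∉ u.1 := fun u s x => by
    rw [← List.mem_toFinset, hlst, mem_compl]
  ext x
  rcases x with x | x <;> simp [pool, h1]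

theorem mergeList_nodup {a : X → List (Fin h)} (ha : ∀ x, (a x).Nodup)
    {lst : FixedCard V h → Ω → List V} (hnd : ∀ u s, (lst u s).Nodup)
    (hlst : ∀ u s, (lst u s).toFinset = u.1ᶜ)
    (i : FixedCard V h × FixedCard V h × (FixedCard (Fin (2 * h)) h × X)) (s : Ω) :
    (mergeList a lst i s).Nodup := by
  refine List.Nodup.append (List.Nodup.append ((hnd _ _).map (Function.Embedding.injective _))
    ((hnd _ _).map (Function.Embedding.injective _)) ?_) ?_ ?_
  · intro x hx hx'
    obtain ⟨y, -, rfl⟩ := List.mem_map.1 hx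
    obtain ⟨z, -, hz⟩ := List.mem_map.1 hx'
    cases hz
  · exact ((ha _).map (enum _ _).injective).map (enum _ _).injective
  · intro x hx hx'
    rw [← List.mem_toFinset, toFinset_append_lists hlst, mem_compl] at hx
    exact hx (remList_subset_pool _ _ _ _ hx')

theorem toFinset_mergeList {a : X → List (Fin h)} (ha : ∀ x, (a x).Nodup)
    (hah : ∀ x, (a x).length = h) {lst : FixedCard V h → Ω → List V}
    (hlst : ∀ u s, (lst u s).toFinset = u.1ᶜ)
    (i : FixedCard V h × FixedCard V h × (FixedCard (Fin (2 * h)) h × X)) (s : Ω) :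
    (mergeList a lst i s).toFinset = (surv i).1ᶜ := by
  unfold mergeList surv
  rw [List.toFinset_append, toFinset_append_lists hlst, toFinset_remList ha hah]
  ext x
  simp only [mem_union, mem_compl, mem_sdiff]
  tauto

/-- In each of the three blocks some coordinates are frozen and the rest are still random. The seed
`s` serves the first two blocks, since the set listed in the first one is determined by the
survivors alone. -/
theorem hazAt_mergeList [Fintype X] [Fintype Ω] {a : X → List (Fin h)} (ha : ∀ x, (a x).Nodup)
    (hah : ∀ x, (a x).length = h) (hX : ∀ k < h, ExactAt k a) {lst : FixedCard V h → Ω → List V}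
    (hnd : ∀ u s, (lst u s).Nodup) (hlst : ∀ u s, (lst u s).toFinset = u.1ᶜ) {β : ℝ} (hβ : 0 ≤ β)
    (hβh : 1 ≤ β * h) {μ : FixedCard V h → ℝ} (hμ : ∀ u, 0 ≤ μ u)
    (H : ∀ k, HazAt k β (fun j : FixedCard V h × Ω => μ j.1) (fun j => lst j.1 j.2)) (k : ℕ) :
    HazAt k β (fun j : (FixedCard V h × FixedCard V h × (FixedCard (Fin (2 * h)) h × X)) × Ω => μ j.1.1 * μ j.1.2.1)
      (fun j => mergeList a lst j.1 j.2) := by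
  have hlen : ∀ u s, (lst u s).length = Fintype.card V - h := fun u s => by
    rw [← List.toFinset_card_of_nodup (hnd u s), hlst, card_compl, u.2]
  have hnd' := mergeList_nodup ha hnd hlst
  rcases lt_or_ge k (Fintype.card V - h) with hk | hk
  -- First copy: freeze `u₂` and the removal; `u₁` and `s` stay random.
  · refine hazAt_of_fibers (A := FixedCard V h × (FixedCard (Fin (2 * h)) h × X)) (Ω := FixedCard V h × Ω)
      ⟨fun p => ((p.2.1, p.1.1, p.1.2), p.2.2), fun q => ((q.1.2.1, q.1.2.2), (q.1.1, q.2)),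
        fun _ => rfl, fun _ => rfl⟩ fun b => ?_
    have h1 := ((H k).map (Function.Embedding.inl : V ↪ V ⊕ V) (fun j => hμ _) hβ).scale (hμ b.1)
    have h2 := (h1.append_left (fun j => (lst b.1 j.2).map Function.Embedding.inr)
      (fun j => by rw [List.length_map, hlen]; exact hk)).append_left
      (fun j => remList a j.1 b.1 b.2)
      (fun j => by rw [List.length_append, List.length_map, hlen]; omega)
    convert h2 using 2
    · exact mul_comm _ _
    · rfl
  rcases lt_or_ge k (2 * (Fintype.card V - h)) with hk2 | hk2
  -- Second copy: freeze `u₁` and the removal. The first block orders the fixed set `u₁ᶜ`, so `u₂`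
  -- and `s` are random as before.
  · refine hazAt_of_fibers (A := FixedCard V h × (FixedCard (Fin (2 * h)) h × X)) (Ω := FixedCard V h × Ω)
      ⟨fun p => ((p.1.1, p.2.1, p.1.2), p.2.2), fun q => ((q.1.1, q.1.2.2), (q.1.2.1, q.2)),
        fun _ => rfl, fun _ => rfl⟩ fun b => ?_
    have hS : #((b.1.1ᶜ).map (Function.Embedding.inl : V ↪ V ⊕ V)) = Fintype.card V - h := by
      rw [card_map, card_compl, b.1.2]
    have h1 := ((H (k - (Fintype.card V - h))).map (Function.Embedding.inr : V ↪ V ⊕ V)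
      (fun j => hμ _) hβ).scale (hμ b.1)
    rw [← hS] at h1
    have h2 := (h1.append_right (a := fun j => (lst b.1 j.2).map Function.Embedding.inl) hβ
      (fun j => mul_nonneg (hμ _) (hμ _)) (fun j => (hnd' (b.1, j.1, b.2) j.2).of_append_left)
      (fun j => ?_) (by rw [hS]; exact hk)).append_left
      (fun j => remList a b.1 j.1 b.2)
      (fun j => by rw [List.length_append, List.length_map, List.length_map, hlen, hlen]; omega)
    · exact h2
    · rw [← hlst b.1 j.2]
      ext
      simp only [List.mem_toFinset, List.mem_map, Finset.mem_map]
  -- Pool: freeze `u₁`, `u₂` and `s`; only the removal is random.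
  · refine hazAt_of_fibers (A := FixedCard V h × FixedCard V h × Ω) (Ω := FixedCard (Fin (2 * h)) h × X)
      ⟨fun p => ((p.1.1, p.1.2.1, p.2), p.1.2.2), fun q => ((q.1.1, q.1.2.1, q.2), q.1.2.2),
        fun _ => rfl, fun _ => rfl⟩ fun b => ?_
    have h1 := (hazAt_remList ha hah hX hβ hβh b.1 b.2.1 (k - #(pool b.1 b.2.1)ᶜ)).scale
      (mul_nonneg (hμ b.1) (hμ b.2.1))
    have h2 := h1.append_right (a := fun _ => (lst b.1 b.2.2).map Function.Embedding.inl ++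
      (lst b.2.1 b.2.2).map Function.Embedding.inr) hβ
      (fun j => mul_nonneg (mul_nonneg (hμ _) (hμ _)) zero_le_one)
      (fun τ => hnd' (b.1, b.2.1, τ) b.2.2)
      (fun j => toFinset_append_lists hlst _ _ _) ?_
    · convert h2 using 2
      · exact (mul_one _).symm
      · rfl
    · rw [card_compl, card_pool, Fintype.card_sum]; omega

end Merge

theorem card_removals_le {X : Type} {h : ℕ} [Fintype X] {A : Finset (Fin (2 * h))} (hA : #A ≤ h) :
    Fintype.card (FixedCard (Fin (2 * h)) h × X) ≤ 16 ^ #A *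
      #{τ : FixedCard (Fin (2 * h)) h × X | Disjoint τ.1.1 A} := by
  have h1 : #{S : FixedCard (Fin (2 * h)) h | Disjoint S.1 A} = (2 * h - #A).choose h := by
    have : #Aᶜ = 2 * h - #A := by rw [card_compl, Fintype.card_fin]
    rw [← this, ← card_powersetCard]
    refine card_bij (fun S _ => S.1) ?_ (fun S _ S' _ h => Subtype.ext h) ?_
    · intro S hS
      rw [mem_powersetCard]
      exact ⟨subset_compl_iff_disjoint_right.2 (mem_filter.1 hS).2, S.2⟩
    · intro S hS
      rw [mem_powersetCard] at hS
      exact ⟨⟨S, hS.2⟩, mem_filter.2 ⟨mem_univ _, subset_compl_iff_disjoint_right.1 hS.1⟩, rfl⟩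
  have h2 : (univ.filter fun τ : FixedCard (Fin (2 * h)) h × X => Disjoint τ.1.1 A) =
      (univ.filter fun S : FixedCard (Fin (2 * h)) h => Disjoint S.1 A) ×ˢ univ := by
    ext; simp
  rw [h2, card_product, h1, Fintype.card_prod, Fintype.card_finset_len, Fintype.card_fin,
    card_univ, ← mul_assoc]
  exact Nat.mul_le_mul_right _ (choose_two_mul_le hA)

section

variable {V X : Type} {h : ℕ} [DecidableEq V]

theorem subset_surv_iff {u₁ u₂ : FixedCard V h} {τ : FixedCard (Fin (2 * h)) h × X}
    {A : Finset (Fin (2 * h))} :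
    A.map (enum (pool u₁ u₂) (card_pool u₁ u₂)) ⊆ (surv (u₁, u₂, τ)).1 ↔ Disjoint τ.1.1 A := by
  unfold surv
  simp only [subset_iff, Finset.disjoint_right, mem_sdiff, Finset.mem_map]
  constructor
  · intro H x hx hx'
    exact (H ⟨x, hx, rfl⟩).2 ⟨x, hx', rfl⟩
  · rintro H _ ⟨x, hx, rfl⟩
    refine ⟨enum_mem _ _ _, ?_⟩
    rintro ⟨y, hy, hyx⟩
    rw [(enum _ _).injective hyx] at hy
    exact H hx hy

variable [Fintype V] [Fintype X]

/-- `A` survives if its two parts survive in their copies, which are independent, and the removed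
half of the pool then avoids `A`; the last event costs `16^(-#A)`. Bounding all `A`, not only
`h`-sets, makes the induction possible, because the parts of an `h`-set are smaller. -/
theorem sum_surv_ge {μ : FixedCard V h → ℝ} (hμ : ∀ u, 0 ≤ μ u) {q : ℝ} (hq : 0 ≤ q)
    (H : ∀ A : Finset V, #A ≤ h → q ^ #A ≤ ∑ u, if A ⊆ u.1 then μ u else 0)
    {A : Finset (V ⊕ V)} (hA : #A ≤ h) :
    (q * (1 / 16)) ^ #A * ((Fintype.card (FixedCard (Fin (2 * h)) h × X) : ℕ) : ℝ) ≤
      ∑ i : FixedCard V h × FixedCard V h × (FixedCard (Fin (2 * h)) h × X),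
        if A ⊆ (surv i).1 then μ i.1 * μ i.2.1 else 0 := by
  have hc : #A.toLeft + #A.toRight = #A := card_toLeft_add_card_toRight
  have hsplit : ∀ f : FixedCard V h × FixedCard V h × (FixedCard (Fin (2 * h)) h × X) → ℝ,
      ∑ i, f i = ∑ u₁, ∑ u₂, ∑ τ, f (u₁, u₂, τ) := fun f => by
    rw [Fintype.sum_prod_type]
    exact sum_congr rfl fun u₁ _ => Fintype.sum_prod_type _
  have hcard : ∀ A' : Finset (Fin (2 * h)), #A' ≤ h →
      ((Fintype.card (FixedCard (Fin (2 * h)) h × X) : ℕ) : ℝ) ≤ 16 ^ #A' *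
        (#{τ : FixedCard (Fin (2 * h)) h × X | Disjoint τ.1.1 A'} : ℝ) := fun A' hA' => by
    exact_mod_cast card_removals_le (X := X) hA'
  have hT0 : (0 : ℝ) ≤ ((Fintype.card (FixedCard (Fin (2 * h)) h × X) : ℕ) : ℝ) :=
    Nat.cast_nonneg _
  generalize ((Fintype.card (FixedCard (Fin (2 * h)) h × X) : ℕ) : ℝ) = T at hcard hT0 ⊢
  have key : ∀ u₁ u₂ : FixedCard V h,
      (1 / 16 : ℝ) ^ #A * T * ((if A.toLeft ⊆ u₁.1 then μ u₁ else 0) *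
        (if A.toRight ⊆ u₂.1 then μ u₂ else 0)) ≤
      ∑ τ : FixedCard (Fin (2 * h)) h × X,
        if A ⊆ (surv (u₁, u₂, τ)).1 then μ u₁ * μ u₂ else 0 := by
    intro u₁ u₂
    have hnn : 0 ≤ ∑ τ : FixedCard (Fin (2 * h)) h × X,
        if A ⊆ (surv (u₁, u₂, τ)).1 then μ u₁ * μ u₂ else 0 :=
      sum_nonneg fun τ _ => by
        split_ifs
        exacts [mul_nonneg (hμ _) (hμ _), le_rfl]
    by_cases h1 : A.toLeft ⊆ u₁.1
    · by_cases h2 : A.toRight ⊆ u₂.1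
      · have hAP : A ⊆ pool u₁ u₂ := by
          rintro (x | x) hx
          · exact inl_mem_disjSum.2 (h1 (mem_toLeft.2 hx))
          · exact inr_mem_disjSum.2 (h2 (mem_toRight.2 hx))
        obtain ⟨A', rfl⟩ := exists_map_enum_eq _ (card_pool u₁ u₂) hAP
        simp only [subset_surv_iff]
        rw [← sum_filter, sum_const, nsmul_eq_mul, if_pos h1, if_pos h2]
        refine mul_le_mul_of_nonneg_right ?_ (mul_nonneg (hμ _) (hμ _))
        rw [card_map] at hA ⊢
        rw [one_div, inv_pow, inv_mul_le_iff₀ (by positivity)]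
        exact hcard _ hA
      · simpa [h2] using hnn
    · simpa [h1] using hnn
  have hL := H A.toLeft (by omega)
  have hR := H A.toRight (by omega)
  have hLR := mul_le_mul hL hR (by positivity) ((by positivity : 0 ≤ q ^ #A.toLeft).trans hL)
  rw [← pow_add, hc] at hLR
  calc (q * (1 / 16)) ^ #A * T = (1 / 16) ^ #A * T * q ^ #A := by rw [mul_pow]; ring
    _ ≤ (1 / 16) ^ #A * T * ((∑ u : FixedCard V h, if A.toLeft ⊆ u.1 then μ u else 0) *
        ∑ u : FixedCard V h, if A.toRight ⊆ u.1 then μ u else 0) :=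
      mul_le_mul_of_nonneg_left hLR (by positivity)
    _ = ∑ u₁ : FixedCard V h, ∑ u₂ : FixedCard V h, (1 / 16 : ℝ) ^ #A * T *
        ((if A.toLeft ⊆ u₁.1 then μ u₁ else 0) * (if A.toRight ⊆ u₂.1 then μ u₂ else 0)) := by
      rw [sum_mul_sum, mul_sum]
      exact sum_congr rfl fun _ _ => mul_sum _ _ _
    _ ≤ ∑ u₁ : FixedCard V h, ∑ u₂ : FixedCard V h, ∑ τ : FixedCard (Fin (2 * h)) h × X,
        if A ⊆ (surv (u₁, u₂, τ)).1 then μ u₁ * μ u₂ else 0 :=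
      sum_le_sum fun u₁ _ => sum_le_sum fun u₂ _ => key u₁ u₂
    _ = _ := by rw [hsplit]

theorem sum_superset_eq (μ : FixedCard V h → ℝ) (u : FixedCard V h) :
    (∑ u' : FixedCard V h, if u.1 ⊆ u'.1 then μ u' else 0) = μ u := by
  rw [sum_eq_single u, if_pos Subset.rfl]
  · intro u' _ hu'
    refine if_neg fun hs => hu' (Subtype.ext (eq_of_subset_of_card_le hs ?_).symm)
    rw [u.2, u'.2]
  · simp

end

/-! ### Iterated merging with shared seeds -/

/-- A family of lists with shared seeds: a random `h`-subset `u` of a set of size `2 ^ d * h`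
survives, and the seed determines, given `u`, a list of the other elements. -/
structure Scheme (h d M : ℕ) (β : ℝ) where
  /-- the ground set -/
  V : Type
  /-- the seeds -/
  Ω : Type
  fintypeV : Fintype V
  decidableEqV : DecidableEq V
  fintypeΩ : Fintype Ω
  card_V : Fintype.card V = 2 ^ d * h
  card_Ω : Fintype.card Ω = M ^ d
  /-- the law of the survivors -/
  μ : FixedCard V h → ℝ
  sum_μ : ∑ u, μ u = 1
  le_sum : ∀ A : Finset V, #A ≤ h → ((1 / 16) ^ d) ^ #A ≤ ∑ u, if A ⊆ u.1 then μ u else 0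
  /-- the lists -/
  lst : FixedCard V h → Ω → List V
  nodup : ∀ u s, (lst u s).Nodup
  toFinset : ∀ u s, (lst u s).toFinset = u.1ᶜ
  hazAt : ∀ k, HazAt k β (fun j : FixedCard V h × Ω => μ j.1) (fun j => lst j.1 j.2)

attribute [instance] Scheme.fintypeV Scheme.decidableEqV Scheme.fintypeΩ

theorem Scheme.le_μ {h d M : ℕ} {β : ℝ} (S : Scheme h d M β) (u : FixedCard S.V h) :
    ((1 / 16) ^ d) ^ h ≤ S.μ u := by
  have := S.le_sum u.1 u.2.le
  rwa [sum_superset_eq, u.2] at this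

theorem Scheme.μ_pos {h d M : ℕ} {β : ℝ} (S : Scheme h d M β) (u : FixedCard S.V h) :
    0 < S.μ u := (by positivity : (0 : ℝ) < ((1 / 16) ^ d) ^ h).trans_le (S.le_μ u)

theorem Scheme.zero (h M : ℕ) {β : ℝ} (hβ : 0 ≤ β) : Nonempty (Scheme h 0 M β) := by
  have hu : ∀ u : FixedCard (Fin h) h, u = ⟨univ, by simp⟩ := fun u =>
    Subtype.ext ((card_eq_iff_eq_univ _).1 (by rw [u.2, Fintype.card_fin]))
  have hun : (univ : Finset (FixedCard (Fin h) h)) = {⟨univ, by simp⟩} := by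
    ext u; simp [hu u]
  exact ⟨{
    V := Fin h
    Ω := Unit
    fintypeV := inferInstance
    decidableEqV := inferInstance
    fintypeΩ := inferInstance
    card_V := by simp
    card_Ω := by simp
    μ := fun _ => 1
    sum_μ := by rw [hun]; simp
    le_sum := fun A _ => by rw [hun, sum_singleton, if_pos (subset_univ A)]; simp
    lst := fun _ _ => []
    nodup := by simp
    toFinset := fun u _ => by rw [hu u]; simp
    hazAt := fun k => hazAt_of_length_le hβ (fun _ => zero_le_one) (by simp) }⟩

theorem Scheme.succ {h d M : ℕ} {β δ : ℝ} (S : Scheme h d M β) (hβ : 0 ≤ β) (hβh : 1 ≤ β * h)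
    (hδ : 0 < δ) (hδ1 : δ < 1) (hM : 64 ^ h ≤ δ * M * ((1 / 16) ^ d) ^ (2 * h)) :
    Nonempty (Scheme h (d + 1) M (β * ((1 + δ) / (1 - δ)))) := by
  classical
  obtain ⟨X, _, a, hXne, ha, hah, -, hX, hcX⟩ := exactFamily h
  let I := FixedCard S.V h × FixedCard S.V h × (FixedCard (Fin (2 * h)) h × X)
  let T := Fintype.card (FixedCard (Fin (2 * h)) h × X)
  let ν : I → ℝ := fun i => S.μ i.1 * S.μ i.2.1
  have hν : ∀ i, 0 < ν i := fun i => mul_pos (S.μ_pos _) (S.μ_pos _)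
  have hT0 : 0 < T := by
    obtain ⟨s, -, hs⟩ := exists_subset_card_eq (s := (univ : Finset (Fin (2 * h)))) (n := h)
      (by rw [card_univ, Fintype.card_fin]; omega)
    exact Fintype.card_pos_iff.2 ⟨⟨⟨s, hs⟩, Classical.arbitrary X⟩⟩
  have hT0' : (0 : ℝ) < T := by exact_mod_cast hT0
  have hT : (T : ℝ) ≤ 64 ^ h := by
    have : T ≤ 64 ^ h := by
      simp only [T]
      rw [Fintype.card_prod, Fintype.card_finset_len, Fintype.card_fin]
      calc _ ≤ 2 ^ (2 * h) * 16 ^ h := Nat.mul_le_mul (Nat.choose_le_two_pow _ _) hcX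
        _ = 64 ^ h := by rw [pow_mul, ← mul_pow]; norm_num
    exact_mod_cast this
  have hsum : ∑ i, ν i = T := by
    rw [Fintype.sum_prod_type, sum_congr rfl fun u₁ _ => Fintype.sum_prod_type _]
    simp only [ν, sum_const, card_univ, nsmul_eq_mul, ← mul_sum, S.sum_μ, mul_one, T]
  have hge : ∀ A : Finset (S.V ⊕ S.V), #A ≤ h → ((1 / 16) ^ (d + 1)) ^ #A * (T : ℝ) ≤
      ∑ i : I, if A ⊆ (surv i).1 then ν i else 0 := fun A hA => by
    rw [pow_succ]
    exact sum_surv_ge (X := X) (fun u => (S.μ_pos u).le) (by positivity) S.le_sum hA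
  -- Each `h`-set has positive mass by `hge`, so its fiber is nonempty and can be rounded.
  have hsurj : Function.Surjective (surv : I → FixedCard (S.V ⊕ S.V) h) := by
    intro u
    by_contra! hne
    have h1 := hge u.1 u.2.le
    rw [sum_eq_zero fun i _ => if_neg fun hs => hne i
      (Subtype.ext (eq_of_subset_of_card_le hs (by rw [u.2, (surv i).2])).symm)] at h1
    exact absurd h1 (not_le.2 (by positivity))
  have hM0 : 0 < M := by
    rcases Nat.eq_zero_or_pos M with rfl | h0
    · simp at hM
      exact absurd hM (not_le.2 (by positivity))
    · exact h0
  -- The total weight is `T ≤ 64^h`, while each history has weight at least the square of the lower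
  -- bound on `μ`; hence the hypothesis on `M`.
  obtain ⟨f, hf, hfν⟩ := exists_coupling (surv : I → FixedCard (S.V ⊕ S.V) h) ν hν hsurj
    (δ := δ) (M := M) (fun i => by
      rw [hsum]
      refine hT.trans (hM.trans ?_)
      refine mul_le_mul_of_nonneg_left ?_ (by positivity)
      rw [mul_comm 2 h, pow_mul, pow_two]
      exact mul_le_mul (S.le_μ _) (S.le_μ _) (by positivity) (S.μ_pos _).le)
  have hfib : ∀ A : Finset (S.V ⊕ S.V),
      (∑ u : FixedCard (S.V ⊕ S.V) h, if A ⊆ u.1 then (T : ℝ)⁻¹ * fiberMass surv ν u else 0) =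
        (T : ℝ)⁻¹ * ∑ i : I, if A ⊆ (surv i).1 then ν i else 0 := fun A => by
    rw [← sum_fiberwise (s := univ) (g := (surv : I → FixedCard (S.V ⊕ S.V) h)), mul_sum]
    refine sum_congr rfl fun u _ => ?_
    rw [sum_congr rfl (g := fun i => if A ⊆ u.1 then ν i else 0) fun i hi => by
      rw [(mem_filter.1 hi).2]]
    unfold fiberMass
    rw [← sum_filter]
    split_ifs
    · congr!
    · simp
  exact ⟨{
    V := S.V ⊕ S.V
    Ω := S.Ω × Fin M
    fintypeV := inferInstance
    decidableEqV := inferInstance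
    fintypeΩ := inferInstance
    card_V := by rw [Fintype.card_sum, S.card_V]; ring
    card_Ω := by rw [Fintype.card_prod, S.card_Ω, Fintype.card_fin, pow_succ]
    μ := fun u => (T : ℝ)⁻¹ * fiberMass surv ν u
    sum_μ := by
      have := hfib ∅
      simp only [empty_subset, if_true] at this
      rw [this, hsum, inv_mul_cancel₀ hT0'.ne']
    le_sum := fun A hA => by
      rw [hfib, ← div_eq_inv_mul, le_div_iff₀ hT0']
      exact hge A hA
    lst := fun u j => mergeList a S.lst (f u j.2) j.1
    nodup := fun u j => mergeList_nodup ha S.nodup S.toFinset _ _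
    toFinset := fun u j => by rw [toFinset_mergeList ha hah S.toFinset, hf]
    hazAt := fun k => by
      have h1 := hazAt_mergeList ha hah hX S.nodup S.toFinset hβ hβh
        (fun u => (S.μ_pos u).le) S.hazAt k
      have h2 := HazAt.coupling hβ hδ.le hδ1 hM0 hf hfν (l := fun i s => mergeList a S.lst i s) h1
      exact h2.scale (c := (T : ℝ)⁻¹) (by positivity) }⟩

theorem Scheme.exists_of_le {h L M : ℕ} {δ : ℝ} (hh : 0 < h) (hδ : 0 < δ) (hδ1 : δ < 1)
    (hM : 64 ^ h ≤ δ * M * ((1 / 16) ^ L) ^ (2 * h)) (d : ℕ) (hd : d ≤ L) :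
    Nonempty (Scheme h d M (1 / h * ((1 + δ) / (1 - δ)) ^ d)) := by
  have hh' : (0 : ℝ) < h := by exact_mod_cast hh
  have h1 : 1 ≤ (1 + δ) / (1 - δ) := by
    rw [le_div_iff₀ (by linarith)]; linarith
  induction d with
  | zero => exact Scheme.zero h M (by positivity)
  | succ d ih =>
    obtain ⟨S⟩ := ih (by omega)
    have hβh : 1 ≤ 1 / (h : ℝ) * ((1 + δ) / (1 - δ)) ^ d * h := by
      rw [mul_right_comm, one_div_mul_cancel hh'.ne', one_mul]
      exact one_le_pow₀ h1
    rw [pow_succ, ← mul_assoc]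
    refine S.succ (by positivity) hβh hδ hδ1 (hM.trans ?_)
    refine mul_le_mul_of_nonneg_left ?_ (by positivity)
    refine pow_le_pow_left₀ (by positivity) ?_ _
    exact pow_le_pow_of_le_one (by norm_num) (by norm_num) (by omega)

/-! ### Partial listings from uniform seeds -/

theorem ratio_pow_le (L : ℕ) :
    ((1 + 1 / (4 * ((L : ℝ) + 1))) / (1 - 1 / (4 * ((L : ℝ) + 1)))) ^ (L + 1) ≤ 4 := by
  have hK : (1 : ℝ) ≤ (L : ℝ) + 1 := by linarith [Nat.cast_nonneg (α := ℝ) L]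
  have h1 : (1 + 1 / (4 * ((L : ℝ) + 1))) / (1 - 1 / (4 * ((L : ℝ) + 1))) ≤
      Real.exp (1 / ((L : ℝ) + 1)) := by
    refine le_trans ?_ (Real.add_one_le_exp _)
    have h2 : 0 < 1 - 1 / (4 * ((L : ℝ) + 1)) := by
      rw [sub_pos, div_lt_one (by linarith)]; linarith
    rw [div_le_iff₀ h2]
    have h3 : 1 / (4 * ((L : ℝ) + 1)) = 1 / ((L : ℝ) + 1) / 4 := by
      field_simp
    rw [h3]
    have h4 : 0 ≤ 1 / ((L : ℝ) + 1) := by positivity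
    have h5 : 1 / ((L : ℝ) + 1) ≤ 1 := by rw [div_le_one (by linarith)]; exact hK
    nlinarith
  have h0 : 0 ≤ (1 + 1 / (4 * ((L : ℝ) + 1))) / (1 - 1 / (4 * ((L : ℝ) + 1))) := by
    refine div_nonneg (by positivity) ?_
    rw [sub_nonneg, div_le_one (by linarith)]; linarith
  calc _ ≤ Real.exp (1 / ((L : ℝ) + 1)) ^ (L + 1) := pow_le_pow_left₀ h0 h1 _
    _ = Real.exp 1 := by
      rw [← Real.exp_nat_mul]
      push_cast
      rw [mul_one_div_cancel (by linarith)]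
    _ ≤ 4 := by linarith [Real.exp_one_lt_d9]

/-- A uniformly distributed family of at most `N` lists of all but `h` elements of a set of size
`m`, each entry having conditional probability at most `β` given the set of previous entries. -/
def PartialFamily (m h N : ℕ) (β : ℝ) : Prop :=
  ∃ (V Ω : Type) (_ : Fintype V) (_ : DecidableEq V) (_ : Fintype Ω) (l : Ω → List V),
    Fintype.card V = m ∧ Nonempty Ω ∧ Fintype.card Ω ≤ N ∧ (∀ s, (l s).Nodup) ∧
    (∀ s, (l s).length = m - h) ∧ ∀ k, HazAt k β (fun _ => 1) l

theorem partialFamily (h L : ℕ) (hh : 0 < h) :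
    PartialFamily (2 ^ L * h) h (2 ^ (9 * h * (L + 1) ^ 2)) (4 / h) := by
  classical
  have hh' : (0 : ℝ) < h := by exact_mod_cast hh
  set δ : ℝ := 1 / (4 * ((L : ℝ) + 1)) with hδdef
  have hK : (1 : ℝ) ≤ (L : ℝ) + 1 := by linarith [Nat.cast_nonneg (α := ℝ) L]
  have hδ : 0 < δ := by positivity
  have hδ1 : δ < 1 := by rw [hδdef, div_lt_one (by linarith)]; linarith
  -- The least `M` allowed at the top level `L`; it is enough at every lower level and for the final
  -- rounding.
  set M : ℕ := 4 * (L + 1) * (16 ^ L) ^ (2 * h) * 64 ^ h with hMdef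
  have hM0 : 0 < M := by positivity
  have hMeq : δ * M * ((1 / 16) ^ L) ^ (2 * h) = 64 ^ h := by
    rw [hδdef, hMdef]
    push_cast
    rw [one_div_pow, one_div_pow]
    field_simp
  obtain ⟨S⟩ := Scheme.exists_of_le hh hδ hδ1 hMeq.ge L le_rfl
  have hsub : Nonempty (FixedCard S.V h) := by
    obtain ⟨s, -, hs⟩ := exists_subset_card_eq (s := (univ : Finset S.V)) (n := h)
      (by rw [card_univ, S.card_V]; exact Nat.le_mul_of_pos_left _ (by positivity))
    exact ⟨⟨s, hs⟩⟩
  obtain ⟨f, hf⟩ := exists_rounding_mul S.μ S.μ_pos (δ := δ) (M := M) (fun u => by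
    rw [S.sum_μ]
    have h1 : (1 : ℝ) ≤ 64 ^ h := one_le_pow₀ (by norm_num)
    refine h1.trans (hMeq.ge.trans ?_)
    refine mul_le_mul_of_nonneg_left ?_ (by positivity)
    refine le_trans ?_ (S.le_μ u)
    refine pow_le_pow_of_le_one (by positivity) ?_ (by omega)
    exact pow_le_one₀ (by norm_num) (by norm_num))
  have hΩ : Nonempty S.Ω := by
    rw [← Fintype.card_pos_iff, S.card_Ω]; positivity
  have hM : M ≤ 2 ^ (9 * h * (L + 1)) := by
    have h1 : 4 * (L + 1) ≤ 2 ^ (L + 2) := by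
      have : L < 2 ^ L := Nat.lt_two_pow_self
      rw [pow_add]; omega
    calc M ≤ 2 ^ (L + 2) * (16 ^ L) ^ (2 * h) * 64 ^ h := by
          rw [hMdef]; gcongr
      _ = 2 ^ (L + 2 + 4 * L * (2 * h) + 6 * h) := by
          rw [pow_add _ (L + 2 + _), pow_add _ (L + 2), pow_mul 2 6, pow_mul 2 (4 * L),
            pow_mul 2 4]
          norm_num
      _ ≤ _ := by
          refine Nat.pow_le_pow_right (by norm_num) ?_
          nlinarith [Nat.zero_le L]
  refine ⟨S.V, Unit × (S.Ω × Fin M), inferInstance, inferInstance, inferInstance,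
    fun j => S.lst (f j.2.2) j.2.1, S.card_V, ?_, ?_, fun s => S.nodup _ _, fun s => ?_,
    fun k => ?_⟩
  · have : Nonempty (Fin M) := ⟨⟨0, hM0⟩⟩
    infer_instance
  · rw [Fintype.card_prod, Fintype.card_prod, S.card_Ω, Fintype.card_unit, Fintype.card_fin,
      one_mul, ← pow_succ, pow_two, ← mul_assoc, pow_mul]
    exact Nat.pow_le_pow_left hM _
  · rw [← List.toFinset_card_of_nodup (S.nodup _ _), S.toFinset, card_compl, S.card_V,
      (f s.2.2).2]
  · have hr : 0 ≤ (1 + δ) / (1 - δ) := div_nonneg (by linarith) (by linarith)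
    -- A last rounding over a one-point base turns the law `μ` of the survivors into a uniform seed.
    -- It is the `(L+1)`-st loss factor.
    have h1 := HazAt.coupling (U := Unit) (f := fun _ => f) (surv := fun _ => ())
      (μ := fun _ => 1) (k := k) (by positivity) hδ.le hδ1 hM0 (fun _ _ => rfl)
      (fun i => by simpa only [S.sum_μ] using hf i) (S.hazAt k)
    refine h1.mono (fun _ => zero_le_one) ?_
    rw [mul_assoc, ← pow_succ, div_eq_mul_one_div 4 (h : ℝ), mul_comm]
    exact mul_le_mul_of_nonneg_right (ratio_pow_le L) (by positivity)

/-! ### Prepending a partial listing and keeping orderings distinct -/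

/-- Greedy choice: a bad new `σ` is determined by the triple `(s, ω, ω')` of its collision, so fewer
than `n!` permutations are bad. -/
theorem exists_disjoint_translates {n : ℕ} {Ω : Type} [Fintype Ω] [Nonempty Ω]
    {l : Ω → List (Fin n)} (hl : ∀ ω, (l ω).Nodup) (hn : ∀ ω, (l ω).length = n) (M : ℕ)
    (hM : M * Fintype.card Ω ^ 2 ≤ n.factorial) :
    ∃ ρ : Fin M → Equiv.Perm (Fin n),
      ∀ s s' ω ω', (l ω).map (ρ s) = (l ω').map (ρ s') → s = s' := by
  classical
  induction M with
  | zero => exact ⟨Fin.elim0, fun s => s.elim0⟩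
  | succ M ih =>
    obtain ⟨ρ, hρ⟩ := ih ((Nat.mul_le_mul_right _ (Nat.le_succ M)).trans hM)
    obtain ⟨σ, hσ⟩ : ∃ σ : Equiv.Perm (Fin n), ∀ s ω ω', (l ω).map σ ≠ (l ω').map (ρ s) := by
      by_contra! hbad
      choose s ω ω' hs using hbad
      have hinj : Function.Injective fun σ => (s σ, ω σ, ω' σ) := by
        intro σ τ hστ
        simp only [Prod.mk.injEq] at hστ
        have h1 : (l (ω σ)).map σ = (l (ω σ)).map τ := by
          rw [hs σ, hστ.1, hστ.2.2, hστ.2.1, hs τ]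
        ext1 x
        refine List.map_inj_left.1 h1 x ?_
        rw [← List.mem_toFinset, toFinset_eq_univ (hl _) (hn _)]
        exact mem_univ x
      have hc := Fintype.card_le_of_injective _ hinj
      rw [Fintype.card_perm, Fintype.card_fin, Fintype.card_prod, Fintype.card_prod,
        Fintype.card_fin] at hc
      have : 0 < Fintype.card Ω := Fintype.card_pos
      have h2 : 0 < Fintype.card Ω ^ 2 := by positivity
      nlinarith
    refine ⟨Fin.cons σ ρ, fun s s' ω ω' h => ?_⟩
    induction s using Fin.cases with
    | zero =>
      induction s' using Fin.cases with
      | zero => rfl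
      | succ t => exact absurd h (hσ t ω ω')
    | succ s =>
      induction s' using Fin.cases with
      | zero => exact absurd h.symm (hσ s ω' ω)
      | succ t => exact congrArg Fin.succ (hρ _ _ _ _ h)

/-- A set of at most `N` orderings of `Fin n` such that, for a uniformly random one, the entry
after the first `k` has conditional probability at most `α / (n - k)` given the set of the first
`k` entries. -/
def FullFamily (α : ℝ) (n : ℕ) (N : ℝ) : Prop :=
  ∃ (Ω : Type) (_ : Fintype Ω) (l : Ω → List (Fin n)), Nonempty Ω ∧ (∀ ω, (l ω).Nodup) ∧
    (∀ ω, (l ω).length = n) ∧ Function.Injective l ∧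
    (∀ k < n, HazAt k (α / ((n : ℝ) - k)) (fun _ => 1) l) ∧ (Fintype.card Ω : ℝ) ≤ N

theorem FullFamily.mono {α N N' : ℝ} {n : ℕ} (H : FullFamily α n N) (h : N ≤ N') :
    FullFamily α n N' := by
  obtain ⟨Ω, i, l, j1, j2, j3, j4, j5, j6⟩ := H
  exact ⟨Ω, i, l, j1, j2, j3, j4, j5, j6.trans h⟩

theorem fullFamily_of_le {α : ℝ} {n : ℕ} (h : (n : ℝ) ≤ α) : FullFamily α n 1 := by
  refine ⟨Unit, inferInstance, fun _ => List.finRange n, inferInstance,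
    fun _ => List.nodup_finRange n, by simp, fun _ _ _ => rfl, fun k hk => ?_, by simp⟩
  refine hazAt_of_one_le (fun _ => zero_le_one) ?_
  have h1 : (k : ℝ) < n := by exact_mod_cast hk
  rw [le_div_iff₀ (by linarith)]
  linarith [Nat.cast_nonneg (α := ℝ) k]

theorem ExactFamily.fullFamily {α : ℝ} {n N : ℕ} (H : ExactFamily n N) (hα : 1 ≤ α) :
    FullFamily α n N := by
  obtain ⟨Ω, i, l, j1, j2, j3, j4, j5, j6⟩ := H
  refine ⟨Ω, i, l, j1, j2, j3, j4, fun k hk => ?_, by exact_mod_cast j6⟩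
  have h1 : (k : ℝ) < n := by exact_mod_cast hk
  have := (j5 k hk).hazAt j2 (by simpa using hk)
  rw [Fintype.card_fin] at this
  exact this.mono (fun _ => zero_le_one)
    (div_le_div_of_nonneg_right hα (by linarith))

/-- Different seeds may give the same partial list, but `X` is a set without multiplicities.
Relabelling the continuation by disjoint translates keeps all orderings distinct and does not change
hazards. -/
theorem FullFamily.extend {α β N : ℝ} {n n' m h Np : ℕ} (H : FullFamily α n' N)
    (P : PartialFamily m h Np β) (hα : 0 ≤ α) (hβ : 0 ≤ β) (hm : m ≤ n)
    (hn' : n' + (m - h) = n) (hβα : β * n ≤ α) (hfac : Np * N ^ 2 ≤ n'.factorial) :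
    FullFamily α n (Np * N) := by
  classical
  obtain ⟨Ω, _, l, hΩ, hl, hln, hinj, hz, hN⟩ := H
  obtain ⟨V, P, _, _, _, p, hV, hP, hPN, hp, hpl, hpz⟩ := P
  obtain ⟨ρ, hρ⟩ := exists_disjoint_translates hl hln (Fintype.card P) (by
    have h1 : ((Fintype.card P * Fintype.card Ω ^ 2 : ℕ) : ℝ) ≤ (n'.factorial : ℕ) := by
      push_cast
      refine le_trans ?_ hfac
      have : (Fintype.card P : ℝ) ≤ Np := by exact_mod_cast hPN
      gcongr
    exact_mod_cast h1)
  let j : V ↪ Fin n := (Function.Embedding.nonempty_of_card_le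
    (by rw [hV, Fintype.card_fin]; exact hm)).some
  have hcard : ∀ s, #((p s).map j).toFinsetᶜ = n' := fun s => by
    rw [card_compl, List.toFinset_card_of_nodup ((hp s).map j.injective), List.length_map, hpl,
      Fintype.card_fin]
    omega
  let e : P → (Fin n' ↪ Fin n) := fun s => enum _ (hcard s)
  let ρ' : P → Equiv.Perm (Fin n') := fun s => ρ (Fintype.equivFin P s)
  let q : P × Ω → List (Fin n) := fun i =>
    (p i.1).map j ++ ((l i.2).map (ρ' i.1).toEmbedding).map (e i.1)
  have hqn : ∀ i, (q i).Nodup := fun i => by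
    refine List.Nodup.append ((hp _).map j.injective)
      (((hl _).map (Equiv.injective _)).map (e i.1).injective) ?_
    intro x hx hx'
    obtain ⟨y, -, rfl⟩ := List.mem_map.1 hx'
    exact mem_compl.1 (enum_mem _ (hcard i.1) y) (List.mem_toFinset.2 hx)
  have hql : ∀ i, (q i).length = n := fun i => by
    simp only [q, List.length_append, List.length_map, hpl, hln]
    omega
  refine ⟨P × Ω, inferInstance, q, inferInstance, hqn, hql, ?_, fun k hk => ?_, ?_⟩
  · rintro ⟨s, ω⟩ ⟨s', ω'⟩ h
    obtain ⟨h1, h2⟩ := List.append_inj h (by simp [hpl])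
    -- The enumeration of the remaining elements depends only on the set already listed, so equal
    -- prefixes leave the translates to separate `s` from `s'`.
    have he : e s = e s' := by
      simp only [e]
      congr 1
      rw [h1]
    rw [he] at h2
    have h3 := (e s').injective.list_map h2
    have h4 := hρ _ _ _ _ h3
    obtain rfl : s = s' := (Fintype.equivFin P).injective h4
    have h5 : ω = ω' := hinj ((Equiv.injective _).list_map h3)
    rw [h5]
  · have hk' : (k : ℝ) < n := by exact_mod_cast hk
    have hk0 : (0 : ℝ) ≤ k := Nat.cast_nonneg k
    have hpos : 0 ≤ α / ((n : ℝ) - k) := div_nonneg hα (by linarith)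
    rcases lt_or_ge k (m - h) with hkm | hkm
    · refine hazAt_of_fibers (Equiv.prodComm Ω P) fun ω => ?_
      have h1 := (((hpz k).map j (fun _ => zero_le_one) hβ).append_left
        (fun s => ((l ω).map (ρ' s).toEmbedding).map (e s))
        (fun s => by rw [List.length_map, hpl]; exact hkm))
      refine HazAt.mono (fun _ => zero_le_one) ?_ h1
      rw [le_div_iff₀ (by linarith)]
      nlinarith
    · refine hazAt_of_fibers (Equiv.refl _) fun s => ?_
      have hS : #((p s).map j).toFinset = m - h := by
        rw [List.toFinset_card_of_nodup ((hp s).map j.injective), List.length_map, hpl]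
      have hc : ((n' : ℝ) - (k - (m - h) : ℕ)) = n - k := by
        rw [Nat.cast_sub hkm, ← hn']
        push_cast
        ring
      have h0 := hz (k - (m - h)) (by omega)
      rw [hc, ← hS] at h0
      have h1 := (h0.map (ρ' s).toEmbedding (fun _ => zero_le_one) hpos).map (e s)
        (fun _ => zero_le_one) hpos
      exact h1.append_right (a := fun _ => (p s).map j) hpos (fun _ => zero_le_one)
        (fun ω => hqn (s, ω)) (fun _ => rfl) (by rw [hS]; exact hkm)
  · rw [Fintype.card_prod]
    push_cast
    have : (Fintype.card P : ℝ) ≤ Np := by exact_mod_cast hPN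
    gcongr

/-! ### Choice of scales and recursion on `n` -/

/-- Since `n' ≥ 32 ≥ e^3`, the bound `n'^n' ≤ e^n' * n'!` gives `n'! ≥ e^(2n')`. -/
theorem exp_le_factorial {n' n : ℕ} (h : (n : ℝ) ≤ 2 * n') (hn : 64 ≤ n) :
    Real.exp n ≤ n'.factorial := by
  have h1 : (64 : ℝ) ≤ n := by exact_mod_cast hn
  have h2 : (0 : ℝ) < n' := by linarith
  have h3 : Real.exp 3 ≤ n' := by
    have : Real.exp 3 = Real.exp 1 ^ 3 := by rw [← Real.exp_nat_mul]; norm_num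
    have h4 : Real.exp 1 ≤ 3 := by linarith [Real.exp_one_lt_d9]
    have h5 : Real.exp 1 ^ 3 ≤ 3 ^ 3 := pow_le_pow_left₀ (Real.exp_pos _).le h4 3
    rw [this]; linarith
  have h4 := Real.pow_div_factorial_le_exp (n' : ℝ) h2.le n'
  have h5 : (0 : ℝ) < n'.factorial := by exact_mod_cast n'.factorial_pos
  rw [div_le_iff₀ h5] at h4
  have h6 : Real.exp 3 ^ n' ≤ (n' : ℝ) ^ n' := pow_le_pow_left₀ (Real.exp_pos _).le h3 _
  have h7 : Real.exp n * Real.exp n' ≤ Real.exp n' * n'.factorial := by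
    refine le_trans ?_ (h6.trans h4)
    rw [← Real.exp_add, ← Real.exp_nat_mul]
    exact Real.exp_le_exp.2 (by linarith)
  rw [mul_comm] at h7
  exact le_of_mul_le_mul_left h7 (Real.exp_pos _)

theorem exists_scale {α : ℝ} {n : ℕ} (hα : 64 ≤ α) (hn : α < n) :
    ∃ h L : ℕ, 0 < h ∧ (4 / h : ℝ) * n ≤ α ∧ (h : ℝ) ≤ 5 * (n / α) ∧ 2 * (2 ^ L * h) ≤ n ∧
      n < 4 * (2 ^ L * h) ∧ ((L : ℝ) + 1) ^ 2 ≤ 8 * (1 + Real.log α ^ 2) := by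
  have hα0 : 0 < α := by linarith
  have hn0 : (0 : ℝ) < n := by linarith
  have h1 : 1 ≤ n / α := by rw [le_div_iff₀ hα0]; linarith
  set h : ℕ := ⌈4 * (n / α)⌉₊ with hh
  have hlo : 4 * (n / α) ≤ h := Nat.le_ceil _
  have hup : (h : ℝ) ≤ 5 * (n / α) := by
    have := (Nat.ceil_lt_add_one (by positivity : 0 ≤ 4 * (n / α))).le
    linarith
  have hpos : (0 : ℝ) < h := by linarith
  have hposN : 0 < h := by exact_mod_cast hpos
  have h2n : 2 * h ≤ n := by
    have : (2 * h : ℝ) ≤ n := by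
      have h3 : n / α * 64 ≤ n := by
        rw [div_mul_eq_mul_div, div_le_iff₀ hα0]; nlinarith
      linarith
    exact_mod_cast this
  have hq : n / (2 * h) ≠ 0 := (Nat.div_pos h2n (by omega)).ne'
  -- This `L` puts `2^L * h` in `(n/4, n/2]`; as `h ≥ 4n/α`, also `2^L ≤ α`, so `L = O(log α)`.
  refine ⟨h, Nat.log 2 (n / (2 * h)), hposN, ?_, hup, ?_, ?_, ?_⟩
  · rw [div_mul_eq_mul_div, div_le_iff₀ hpos]
    have := mul_le_mul_of_nonneg_left hlo hα0.le
    calc (4 * n : ℝ) = α * (4 * (n / α)) := by field_simp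
      _ ≤ α * h := this
  · have := Nat.pow_log_le_self 2 hq
    rw [Nat.le_div_iff_mul_le (by omega)] at this
    linarith
  · have := Nat.lt_pow_succ_log_self (b := 2) (by norm_num) (n / (2 * h))
    rw [Nat.div_lt_iff_lt_mul (by omega), pow_succ] at this
    linarith
  · set L := Nat.log 2 (n / (2 * h))
    have h3 : (2 : ℝ) ^ L * (2 * h) ≤ n := by
      have := Nat.pow_log_le_self 2 hq
      rw [Nat.le_div_iff_mul_le (by omega)] at this
      exact_mod_cast this
    have h4 : (2 : ℝ) ^ L ≤ α := by
      have h5 : (2 : ℝ) ^ L * (8 * (n / α)) ≤ n :=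
        le_trans (mul_le_mul_of_nonneg_left (by linarith) (by positivity)) h3
      have h6 : (2 : ℝ) ^ L * 8 ≤ α := by
        have e : (2 : ℝ) ^ L * (8 * (n / α)) = (2 ^ L * 8 / α) * n := by ring
        rw [e] at h5
        have : (2 : ℝ) ^ L * 8 / α ≤ 1 := by
          by_contra! hc
          nlinarith
        rwa [div_le_one hα0] at this
      linarith [pow_pos (by norm_num : (0 : ℝ) < 2) L]
    have h5 : (L : ℝ) * Real.log 2 ≤ Real.log α := by
      rw [← Real.log_pow]
      exact Real.log_le_log (by positivity) h4
    have h6 := Real.log_two_gt_d9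
    have h7 : (L : ℝ) ≤ 2 * Real.log α := by nlinarith [Nat.cast_nonneg (α := ℝ) L]
    have h8 : (0 : ℝ) ≤ L := Nat.cast_nonneg L
    nlinarith [sq_nonneg (2 * Real.log α - 1)]

/-- With `B = (1 + log² α)/α`, one round costs `360nB` in the exponent, and `360 + (7/8)·2880 =
2880` closes the induction. Disjoint translates need `(360 + 2·(7/8)·2880)nB ≤ n`, which `6120B ≤ 1`
ensures. -/
theorem fullFamily_of_large {α : ℝ} (hα : 64 ≤ α)
    (hlog : 6120 * (1 + Real.log α ^ 2) ≤ α) (n : ℕ) :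
    FullFamily α n (Real.exp (2880 * (n / α * (1 + Real.log α ^ 2)))) := by
  have hα0 : 0 < α := by linarith
  set B : ℝ := (1 + Real.log α ^ 2) / α with hB
  have hB0 : 0 < B := by positivity
  have hB1 : 6120 * B ≤ 1 := by
    rw [hB, mul_div_assoc', div_le_one hα0]; exact hlog
  have hnB : ∀ n : ℕ, (n : ℝ) / α * (1 + Real.log α ^ 2) = n * B := fun n => by
    rw [hB]; ring
  simp only [hnB]
  induction n using Nat.strong_induction_on with
  | _ n ih =>
    rcases le_or_gt (n : ℝ) α with hn | hn
    · exact (fullFamily_of_le hn).mono (Real.one_le_exp (by positivity))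
    obtain ⟨h, L, hh, hhα, hhup, h1, h2, hL⟩ := exists_scale hα hn
    have hn0 : (0 : ℝ) < n := by linarith
    have hhn : 8 * h ≤ n := by
      have h3 : n / α * 64 ≤ n := by
        rw [div_mul_eq_mul_div, div_le_iff₀ hα0]; nlinarith
      have : (8 * h : ℝ) ≤ n := by linarith [div_pos hn0 hα0]
      exact_mod_cast this
    have hle : h ≤ 2 ^ L * h := Nat.le_mul_of_pos_left _ (by positivity)
    have hlt : n - (2 ^ L * h - h) < n := by omega
    have hup : ((n - (2 ^ L * h - h) : ℕ) : ℝ) ≤ 7 / 8 * n := by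
      have : 8 * (n - (2 ^ L * h - h)) ≤ 7 * n := by omega
      have : (8 * (n - (2 ^ L * h - h) : ℕ) : ℝ) ≤ 7 * n := by exact_mod_cast this
      linarith
    have hlo : (n : ℝ) ≤ 2 * (n - (2 ^ L * h - h) : ℕ) := by
      have : n ≤ 2 * (n - (2 ^ L * h - h)) := by omega
      exact_mod_cast this
    have H := ih _ hlt
    have hs : n - (2 ^ L * h - h) + (2 ^ L * h - h) = n := by omega
    generalize n - (2 ^ L * h - h) = n' at *
    have hseed : ((2 ^ (9 * h * (L + 1) ^ 2) : ℕ) : ℝ) ≤ Real.exp (360 * (n * B)) := by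
      have h3 : (2 : ℝ) ≤ Real.exp 1 := by linarith [Real.exp_one_gt_d9]
      push_cast
      refine (pow_le_pow_left₀ (by norm_num) h3 _).trans ?_
      rw [← Real.exp_nat_mul, mul_one]
      refine Real.exp_le_exp.2 ?_
      push_cast
      calc (9 * h * ((L : ℝ) + 1) ^ 2) ≤
          9 * (5 * (n / α)) * (8 * (1 + Real.log α ^ 2)) := by gcongr
        _ = 360 * (n / α * (1 + Real.log α ^ 2)) := by ring
        _ = _ := by rw [hnB]
    have hnB' : (n' : ℝ) * B ≤ 7 / 8 * (n * B) := by nlinarith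
    have hn64 : 64 ≤ n := by
      have : (64 : ℝ) ≤ n := by linarith
      exact_mod_cast this
    refine (H.extend (partialFamily h L hh) hα0.le (by positivity) (by omega) hs hhα
      ?_).mono ?_
    · refine le_trans ?_ (exp_le_factorial hlo hn64)
      rw [← Real.exp_nat_mul]
      refine (mul_le_mul_of_nonneg_right hseed (Real.exp_pos _).le).trans ?_
      rw [← Real.exp_add]
      refine Real.exp_le_exp.2 ?_
      push_cast
      nlinarith
    · refine (mul_le_mul_of_nonneg_right hseed (Real.exp_pos _).le).trans ?_
      rw [← Real.exp_add]
      exact Real.exp_le_exp.2 (by linarith)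

theorem exists_log_sq_le : ∃ α₀ : ℝ, 64 ≤ α₀ ∧
    ∀ α, α₀ ≤ α → 6120 * (1 + Real.log α ^ 2) ≤ α := by
  have h := (Real.isLittleO_pow_log_id_atTop (n := 2)).def (c := 1 / 12240) (by norm_num)
  obtain ⟨a, ha⟩ := Filter.eventually_atTop.1 h
  refine ⟨max a 12240, (by norm_num : (64 : ℝ) ≤ 12240).trans (le_max_right _ _), fun α hα => ?_⟩
  have h1 := ha α ((le_max_left _ _).trans hα)
  have h2 : 12240 ≤ α := (le_max_right _ _).trans hα
  rw [Real.norm_of_nonneg (sq_nonneg _), id, Real.norm_of_nonneg (by linarith)] at h1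
  linarith

theorem exists_fullFamily : ∃ C : ℝ, 0 < C ∧ ∀ α : ℝ, 1 < α → ∀ n : ℕ,
    FullFamily α n (Real.exp (C * (n / α * (1 + Real.log α ^ 2)))) := by
  obtain ⟨α₀, hα₀, hlog⟩ := exists_log_sq_le
  refine ⟨2880 + 3 * α₀, by linarith, fun α hα n => ?_⟩
  have hα0 : 0 < α := by linarith
  have hnn : 0 ≤ (n : ℝ) / α := by positivity
  have hl : 1 ≤ 1 + Real.log α ^ 2 := by linarith [sq_nonneg (Real.log α)]
  rcases le_or_gt α₀ α with h | h
  · refine (fullFamily_of_large (hα₀.trans h) (hlog α h) n).mono (Real.exp_le_exp.2 ?_)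
    refine mul_le_mul_of_nonneg_right (by linarith) (by positivity)
  -- For `α < α₀` one has `n ≤ α₀ * (n/α)`, so `16^n ≤ e^(3n)` is affordable.
  · refine ((exactFamily n).fullFamily hα.le).mono ?_
    have h16 : (16 : ℝ) ≤ Real.exp 3 := by
      have e : Real.exp 3 = Real.exp 1 ^ 3 := by rw [← Real.exp_nat_mul]; norm_num
      have h5 : (2.7 : ℝ) ^ 3 ≤ Real.exp 1 ^ 3 :=
        pow_le_pow_left₀ (by norm_num) (by linarith [Real.exp_one_gt_d9]) 3
      rw [e]
      refine le_trans ?_ h5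
      norm_num
    push_cast
    refine (pow_le_pow_left₀ (by norm_num) h16 n).trans ?_
    rw [← Real.exp_nat_mul]
    refine Real.exp_le_exp.2 ?_
    have h6 : (n : ℝ) ≤ n / α * α₀ := by
      rw [div_mul_eq_mul_div, le_div_iff₀ hα0]
      exact mul_le_mul_of_nonneg_left h.le (Nat.cast_nonneg n)
    calc (n : ℝ) * 3 ≤ (3 * α₀) * (n / α * 1) := by linarith
      _ ≤ (2880 + 3 * α₀) * (n / α * (1 + Real.log α ^ 2)) := by gcongr; linarith

/-! ### From lists back to permutations -/

/-- The permutation of which `l` is the list of values, backwards. -/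
noncomputable def revPerm {n : ℕ} (l : List (Fin n)) (hl : l.Nodup) (hn : l.length = n) :
    Equiv.Perm (Fin n) :=
  Equiv.ofBijective (fun i => l[(i.rev : ℕ)]'(hn.symm ▸ i.rev.isLt))
    (Finite.injective_iff_bijective.1 fun i j h => by
      have := (hl.getElem_inj_iff).1 h
      exact Fin.rev_injective (Fin.ext this))

theorem revPerm_apply {n : ℕ} {l : List (Fin n)} (hl : l.Nodup) (hn : l.length = n) (i : Fin n) :
    l[(i.rev : ℕ)]? = some (revPerm l hl hn i) :=
  List.getElem?_eq_getElem _

theorem prefixSet_revPerm {n : ℕ} {l : List (Fin n)} (hl : l.Nodup) (hn : l.length = n) {m : ℕ}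
    (hm : m ≤ n) : prefixSet (revPerm l hl hn) m = (l.take (n - m)).toFinsetᶜ := by
  have hsub : prefixSet (revPerm l hl hn) m ⊆ (l.take (n - m)).toFinsetᶜ := by
    intro x hx
    unfold prefixSet at hx
    simp only [mem_image, mem_filter, mem_univ, true_and] at hx
    obtain ⟨j, hj, rfl⟩ := hx
    rw [mem_compl, List.mem_toFinset, List.mem_take_iff_getElem]
    rintro ⟨i, hi, hij⟩
    have h1 := (hl.getElem_inj_iff (hi := by omega) (hj := hn.symm ▸ j.rev.isLt)).1 hij
    rw [Fin.val_rev] at h1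
    omega
  refine eq_of_subset_of_card_le hsub ?_
  rw [card_compl, List.toFinset_card_of_nodup (hl.sublist (List.take_sublist _ _)),
    List.length_take, Fintype.card_fin, prefixSet, card_image_of_injective _ (Equiv.injective _),
    Fin.card_filter_val_lt]
  omega

theorem revPerm_injective {n : ℕ} {l l' : List (Fin n)} (hl : l.Nodup) (hn : l.length = n)
    (hl' : l'.Nodup) (hn' : l'.length = n) (h : revPerm l hl hn = revPerm l' hl' hn') :
    l = l' := by
  refine List.ext_getElem? fun i => ?_
  rcases lt_or_ge i n with hi | hi
  · have h1 := revPerm_apply hl hn (Fin.rev ⟨i, hi⟩)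
    have h2 := revPerm_apply hl' hn' (Fin.rev ⟨i, hi⟩)
    rw [Fin.rev_rev] at h1 h2
    rw [h1, h2, h]
  · rw [List.getElem?_eq_none (by omega), List.getElem?_eq_none (by omega)]

theorem prefixSet_revPerm_iff {n : ℕ} {l : List (Fin n)} (hl : l.Nodup) (hn : l.length = n)
    (Y : Finset (Fin n)) :
    prefixSet (revPerm l hl hn) #Y = Y ↔ (l.take #Yᶜ).toFinset = Yᶜ := by
  rw [prefixSet_revPerm hl hn (card_finset_fin_le Y), card_compl, Fintype.card_fin,
    compl_eq_comm, eq_comm]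

theorem mainTheorem5 :
    ∃ C : ℝ, 0 < C ∧ ∀ α : ℝ, 1 < α → ∀ n : ℕ,
      ∃ (X : Finset (Equiv.Perm (Fin n))) (hX : X.Nonempty),
        (X.card : ℝ) ≤ Real.exp (C * ((n : ℝ) / α * (1 + Real.log α ^ 2))) ∧
        BackwardsUniform (PMF.uniformOfFinset X hX) α := by
  classical
  obtain ⟨C, hC, H⟩ := exists_fullFamily
  refine ⟨C, hC, fun α hα n => ?_⟩
  obtain ⟨Ω, _, l, hΩ, hl, hn, hinj, hz, hN⟩ := H α hα n
  let π : Ω → Equiv.Perm (Fin n) := fun ω => revPerm (l ω) (hl ω) (hn ω)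
  have hπ : Function.Injective π := fun ω ω' h => hinj (revPerm_injective _ _ _ _ h)
  have hcard : ∀ (E : Set (Equiv.Perm (Fin n))) (_ : DecidablePred (· ∈ E))
      (Q : List (Fin n) → Prop), (∀ ω, π ω ∈ E ↔ Q (l ω)) →
      (#((univ.image π).filter (· ∈ E)) : ℝ) = mass (fun _ => 1) l Q := fun E _ Q hQ => by
    rw [filter_image, card_image_of_injective _ hπ, mass, ← sum_filter, sum_const, nsmul_eq_mul,
      mul_one, filter_congr fun ω _ => hQ ω]
  refine ⟨univ.image π, univ_nonempty.image π, ?_, ?_⟩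
  · rwa [card_image_of_injective _ hπ, card_univ]
  intro Y _ x _ i hi
  have hYn : #Yᶜ = n - #Y := by rw [card_compl, Fintype.card_fin]
  have hYle : #Y ≤ n := card_finset_fin_le Y
  -- Position `|Y|` of the permutation is the list entry right after the `n - |Y|` elements of `Yᶜ`.
  have hrev : (i.rev : ℕ) = #Yᶜ := by rw [Fin.val_rev, hYn, hi]
  have hα' : 0 ≤ α / (#Y : ℝ) := div_nonneg (by linarith) (Nat.cast_nonneg _)
  have key := hz #Yᶜ (by omega) Yᶜ rfl x
  have hden : (n : ℝ) - #Yᶜ = #Y := by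
    rw [hYn, Nat.cast_sub hYle]; ring
  rw [hden] at key
  have e₁ : ∀ ω, π ω ∈ ({π | π i = x} ∩ {π | prefixSet π #Y = Y} : Set (Equiv.Perm (Fin n))) ↔
      Hits (l ω) Yᶜ x := fun ω => by
    change revPerm (l ω) (hl ω) (hn ω) i = x ∧ prefixSet (revPerm (l ω) (hl ω) (hn ω)) #Y = Y ↔ _
    rw [prefixSet_revPerm_iff, Hits, and_comm, ← hrev, revPerm_apply (hl ω) (hn ω),
      Option.some_inj]
  have e₂ : ∀ ω, π ω ∈ ({π | prefixSet π #Y = Y} : Set (Equiv.Perm (Fin n))) ↔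
      Vis (l ω) Yᶜ := fun ω => by
    change prefixSet (revPerm (l ω) (hl ω) (hn ω)) #Y = Y ↔ _
    rw [prefixSet_revPerm_iff, Vis, hn]
    exact ⟨fun h => ⟨h, by omega⟩, fun h => h.1⟩
  unfold condProb prob
  rw [PMF.toOuterMeasure_uniformOfFinset_apply, PMF.toOuterMeasure_uniformOfFinset_apply]
  refine ENNReal.div_le_of_le_mul ?_
  rw [← mul_div_assoc]
  refine ENNReal.div_le_div_right ?_ _
  rw [← ENNReal.ofReal_natCast, ← ENNReal.ofReal_natCast, ← ENNReal.ofReal_mul hα',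
    hcard _ _ (Hits · Yᶜ x) e₁,
    hcard _ _ (Vis · Yᶜ) e₂]
  exact ENNReal.ofReal_le_ofReal key
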